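/- Terminology. A subset of a topological space is compact if every open cover of it has a finite subcover, and a space is locally compact if every point has a neighbourhood base of compact sets; neither notion includes the Hausdorff property. A groupoid $G$ has source and range maps $s(\gamma)=\gamma^{-1}\gamma$ and $r(\gamma)=\gamma\gamma^{-1}$ onto its unit space $G^{(0)}\subseteq G$. A topological groupoid $G$ (with continuous inversion, and with product continuous on composable pairs) is étale if $s\colon G\to G^{(0)}$ is a local homeomorphism, where $G^{(0)}$ has the subspace topology. For open $U\subseteq G$ let $C_c(U)$ be the set of functions $f\colon G\to\mathbb C$ that are continuous on $U$ and vanish outside some compact subset of $U$. Let $$\mathscr C(G)=\operatorname{span}_{\mathbb C}\{f\in C_c(U) : U\subseteq G \text{ open and Hausdorff}\},$$ a $*$-algebra of functions on $G$ (not necessarily continuous) with pointwise vector space operations, convolution $(f*g)(\gamma)=\sum_{\alpha\beta=\gamma}f(\alpha)g(\beta)$ and involution $f^*(\gamma)=\overline{f(\gamma^{-1})}$. A net $(f_n)$ in $\mathscr C(G)$ converges to $f\in\mathscr C(G)$ in the inductive limit topology if $f_n\to f$ uniformly on $G$ and there is a compact set $K\subseteq G$ with $\{\gamma : f_n(\gamma)\neq0\}\subseteq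 K$ eventually. Theorem. Let $G$ be a second countable, locally compact étale groupoid whose unit space $G^{(0)}$ is Hausdorff ($G$ itself need not be Hausdorff). Let $\mathscr H$ be a complex Hilbert space and let $\pi\colon\mathscr C(G)\to B(\mathscr H)$ be a $*$-homomorphism, that is, a $\mathbb C$-linear, multiplicative, $*$-preserving map. Then $\pi$ is continuous for the inductive limit topology: whenever a net $(f_n)$ in $\mathscr C(G)$ converges to $f\in\mathscr C(G)$ in the inductive limit topology, $\pi(f_n)\to\pi(f)$ in the operator norm. -/

import Mathlib

open Filter Topology

/-- A groupoid, presented by its set `G` of arrows, with a partially defined product and an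
inversion. The product `a * b` is only meaningful when `Composable a b`; the values of the
total function `*` at other pairs are arbitrary and are never used. -/
class ArrowGroupoid (G : Type*) extends Mul G, Inv G where
  Composable : G → G → Prop
  inverse_inverse : ∀ a : G, a⁻¹⁻¹ = a
  composable_mul_left : ∀ {a b c : G}, Composable a b → Composable b c → Composable (a * b) c
  composable_mul_right : ∀ {a b c : G}, Composable a b → Composable b c → Composable a (b * c)
  product_assoc : ∀ {a b c : G}, Composable a b → Composable b c → (a * b) * c = a * (b * c)
  composable_inv_self : ∀ a : G, Composable a⁻¹ a
  composable_self_inv : ∀ a : G, Composable a a⁻¹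
  inv_mul_product : ∀ {a b : G}, Composable a b → a⁻¹ * (a * b) = b
  product_mul_inv : ∀ {a b : G}, Composable a b → (a * b) * b⁻¹ = a

namespace ArrowGroupoid

variable {G : Type*}

/-- The unit space of `G`, as a subset (hence, for topological `G`, a subspace) of `G`. -/
def unitSpace (G : Type*) [ArrowGroupoid G] : Set G := Set.range fun a : G => a⁻¹ * a

/-- The source map `a ↦ a⁻¹ a`, with values in the unit space. -/
def src [ArrowGroupoid G] (a : G) : unitSpace G := ⟨a⁻¹ * a, a, rfl⟩

/-- The range map `a ↦ a a⁻¹`, with values in the unit space. -/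
def rng [ArrowGroupoid G] (a : G) : unitSpace G :=
  ⟨a * a⁻¹, a⁻¹, by simp only [inverse_inverse]⟩

/-- A topological groupoid: inversion is continuous, and the product is continuous on the set of
composable pairs. -/
class IsTopologicalGroupoid (G : Type*) [TopologicalSpace G] [ArrowGroupoid G] : Prop where
  continuous_inverse : Continuous fun a : G => a⁻¹
  continuousOn_product :
    ContinuousOn (fun p : G × G => p.1 * p.2) {p : G × G | Composable p.1 p.2}

/-- An étale groupoid: a topological groupoid whose source map, as a map onto the unit space with
its subspace topology, is a local homeomorphism. -/
class IsEtaleGroupoid (G : Type*) [TopologicalSpace G] [ArrowGroupoid G] : Prop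
    extends IsTopologicalGroupoid G where
  isLocalHomeomorph_src : IsLocalHomeomorph (src : G → unitSpace G)

/-- `C_c(U)`, seen inside the functions `G → ℂ`: functions that are continuous on `U` and vanish
outside some compact subset of `U`. -/
def CcOn [TopologicalSpace G] (U : Set G) : Set (G → ℂ) :=
  {f | ContinuousOn f U ∧ ∃ K ⊆ U, IsCompact K ∧ ∀ x ∉ K, f x = 0}

/-- The underlying vector space of Connes' algebra: the span of the `C_c(U)`, over all open subsets
`U` of `G` that are Hausdorff in the subspace topology. -/
def connesSpan (G : Type*) [TopologicalSpace G] : Submodule ℂ (G → ℂ) :=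
  Submodule.span ℂ {f | ∃ U : Set G, IsOpen U ∧ T2Space U ∧ f ∈ CcOn U}

/-- Convolution: the sum of `f a * g b` over all composable pairs `(a, b)` with `a * b = c`. -/
noncomputable def conv [ArrowGroupoid G] (f g : G → ℂ) (c : G) : ℂ :=
  ∑ᶠ p : {p : G × G // Composable p.1 p.2 ∧ p.1 * p.2 = c}, f p.1.1 * g p.1.2

/-- Involution: `c ↦ conj (f c⁻¹)`. -/
def invol [ArrowGroupoid G] (f : G → ℂ) (c : G) : ℂ := starRingEnd ℂ (f c⁻¹)

/-! ### The convolution algebra is closed under the operations -/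

section algebraic

variable [ArrowGroupoid G]

theorem src_eq_rng_of_composable {a b : G} (h : Composable a b) : src a = rng b := by
  have h1 := composable_mul_left (composable_inv_self a) h
  have h2 : (a⁻¹ * a) * b = b := by
    rw [product_assoc (composable_inv_self a) h, inv_mul_product h]
  have h3 := product_mul_inv h1
  rw [h2] at h3
  exact Subtype.ext h3.symm

theorem rng_mul {a b : G} (h : Composable a b) : rng (a * b) = rng a := by
  have h1 : Composable (a * b) b⁻¹ := composable_mul_left h (composable_self_inv b)
  have h2 : Composable a⁻¹ (a * b) := composable_mul_right (composable_inv_self a) h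
  have h3 := src_eq_rng_of_composable h2
  rw [← h3]
  apply Subtype.ext
  simp [src, rng, inverse_inverse]

theorem composable_of_src_eq_rng {a b : G} (h : src a = rng b) : Composable a b := by
  have h0 : a⁻¹ * a = b * b⁻¹ := congrArg Subtype.val h
  have h1 : Composable a (b * b⁻¹) := by
    rw [← h0]
    exact composable_mul_right (composable_self_inv a) (composable_inv_self a)
  have h2 : Composable (b * b⁻¹) b :=
    composable_mul_left (composable_self_inv b) (composable_inv_self b)
  have h3 : (b * b⁻¹) * b = b := by
    have := product_mul_inv (composable_self_inv b)
    rwa [inverse_inverse] at this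
  have h4 := composable_mul_right h1 h2
  rwa [h3] at h4

theorem src_inverse (a : G) : src a⁻¹ = rng a := by
  apply Subtype.ext
  simp [src, rng, inverse_inverse]

theorem composable_inv_of_rng_eq {a c : G} (h : rng a = rng c) : Composable a⁻¹ c :=
  composable_of_src_eq_rng (by rw [src_inverse, h])

theorem mul_inv_mul {a c : G} (h : rng a = rng c) : a * (a⁻¹ * c) = c := by
  have := inv_mul_product (composable_inv_of_rng_eq h)
  rwa [inverse_inverse] at this

theorem composable_mul_inv_mul {a c : G} (h : rng a = rng c) : Composable a (a⁻¹ * c) :=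
  composable_mul_right (composable_self_inv a) (composable_inv_of_rng_eq h)

theorem finite_conv_support {f : G → ℂ} (hf : ∀ x, {a | rng a = x ∧ f a ≠ 0}.Finite)
    (g : G → ℂ) (c : G) :
    (Function.support fun p : {p : G × G // Composable p.1 p.2 ∧ p.1 * p.2 = c} =>
      f p.1.1 * g p.1.2).Finite := by
  apply Set.Finite.of_finite_image (f := fun p => p.1.1)
  · refine (hf (rng c)).subset ?_
    rintro _ ⟨p, hp, rfl⟩
    refine ⟨?_, left_ne_zero_of_mul hp⟩
    exact (rng_mul p.2.1).symm.trans (congrArg rng p.2.2)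
  · rintro ⟨⟨a, b⟩, h1, h2⟩ - ⟨⟨a', b'⟩, h1', h2'⟩ - h
    simp only at h h1 h2 h1' h2'
    subst h
    have : b = b' := by rw [← inv_mul_product h1, ← inv_mul_product h1', h2, h2']
    subst this
    rfl

theorem conv_add_left {f f' g : G → ℂ} (hf : ∀ x, {a | rng a = x ∧ f a ≠ 0}.Finite)
    (hf' : ∀ x, {a | rng a = x ∧ f' a ≠ 0}.Finite) :
    conv (f + f') g = conv f g + conv f' g := by
  funext c
  simp only [conv, Pi.add_apply, add_mul]
  exact finsum_add_distrib (finite_conv_support hf g c) (finite_conv_support hf' g c)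

theorem conv_add_right {f g g' : G → ℂ} (hf : ∀ x, {a | rng a = x ∧ f a ≠ 0}.Finite) :
    conv f (g + g') = conv f g + conv f g' := by
  funext c
  simp only [conv, Pi.add_apply, mul_add]
  exact finsum_add_distrib (finite_conv_support hf g c) (finite_conv_support hf g' c)

theorem conv_smul_left (t : ℂ) (f g : G → ℂ) : conv (t • f) g = t • conv f g := by
  funext c
  simp only [conv, Pi.smul_apply, smul_mul_assoc]
  exact (smul_finsum t _).symm

theorem conv_smul_right (t : ℂ) (f g : G → ℂ) : conv f (t • g) = t • conv f g := by
  funext c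
  simp only [conv, Pi.smul_apply, mul_smul_comm]
  exact (smul_finsum t _).symm

theorem conv_zero_left (g : G → ℂ) : conv 0 g = 0 := by
  funext c; simp [conv]

theorem conv_zero_right (f : G → ℂ) : conv f 0 = 0 := by
  funext c; simp [conv]

end algebraic

section topological

variable [TopologicalSpace G] [ArrowGroupoid G] [IsEtaleGroupoid G]

theorem continuous_inverse' : Continuous fun a : G => a⁻¹ :=
  IsTopologicalGroupoid.continuous_inverse

/-- Inversion as a homeomorphism. -/
def inverseHomeo (G : Type*) [TopologicalSpace G] [ArrowGroupoid G] [IsEtaleGroupoid G] :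
    G ≃ₜ G where
  toFun a := a⁻¹
  invFun a := a⁻¹
  left_inv := inverse_inverse
  right_inv := inverse_inverse
  continuous_toFun := continuous_inverse'
  continuous_invFun := continuous_inverse'

theorem isLocalHomeomorph_rng : IsLocalHomeomorph (rng : G → unitSpace G) := by
  have h := (IsEtaleGroupoid.isLocalHomeomorph_src (G := G)).comp
    (inverseHomeo G).isLocalHomeomorph
  convert h using 1
  funext a
  exact (src_inverse a).symm

/-- Functions in `C_c(U)` for open sets `U` on which the range map is an open embedding. -/
def sliceFun (G : Type*) [TopologicalSpace G] [ArrowGroupoid G] : Set (G → ℂ) :=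
  {f | ∃ e : OpenPartialHomeomorph G (unitSpace G),
    (e : G → unitSpace G) = rng ∧ f ∈ CcOn e.source}

theorem finite_fiber_of_mem {f : G → ℂ} (hf : f ∈ connesSpan G) (x : unitSpace G) :
    {a | rng a = x ∧ f a ≠ 0}.Finite := by
  induction hf using Submodule.span_induction with
  | mem f hf =>
    obtain ⟨U, -, -, -, K, -, hK, h0⟩ := hf
    choose e he using (isLocalHomeomorph_rng (G := G))
    obtain ⟨t, -, ht⟩ := hK.elim_nhds_subcover (fun a => (e a).source)
      (fun a _ => (e a).open_source.mem_nhds (he a).1)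
    have hfin : (⋃ a ∈ t, {b | b ∈ (e a).source ∧ rng b = x}).Finite := by
      refine Set.Finite.biUnion t.finite_toSet fun a _ => Set.Subsingleton.finite ?_
      rintro b ⟨hb, hbx⟩ b' ⟨hb', hbx'⟩
      apply (e a).injOn hb hb'
      rw [← (he a).2, hbx, hbx']
    refine hfin.subset ?_
    rintro b ⟨hb, hb0⟩
    have hbK : b ∈ K := by
      by_contra h
      exact hb0 (h0 b h)
    obtain ⟨a, ha, hba⟩ := Set.mem_iUnion₂.1 (ht hbK)
    exact Set.mem_iUnion₂.2 ⟨a, ha, hba, hb⟩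
  | zero => simp
  | add f g _ _ hf hg =>
    refine (hf.union hg).subset ?_
    rintro a ⟨ha, h⟩
    by_cases h1 : f a = 0
    · right
      refine ⟨ha, fun h2 => h ?_⟩
      simp [h1, h2]
    · exact Or.inl ⟨ha, h1⟩
  | smul t f _ hf =>
    refine hf.subset ?_
    rintro a ⟨ha, h⟩
    refine ⟨ha, fun h2 => h ?_⟩
    simp [h2]

theorem mem_span_sliceFun [LocallyCompactSpace G] {f : G → ℂ} (hf : f ∈ connesSpan G) :
    f ∈ Submodule.span ℂ (sliceFun G) := by
  classical
  refine Submodule.span_le.2 ?_ hf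
  rintro f ⟨U, hU, hT2, hfU, K, hKU, hK, h0⟩
  choose e he using (isLocalHomeomorph_rng (G := G))
  have hLC : LocallyCompactSpace U := hU.locallyCompactSpace
  obtain ⟨t, -, ht⟩ := hK.elim_nhds_subcover (fun a => (e a).source)
    (fun a _ => (e a).open_source.mem_nhds (he a).1)
  let K' : Set U := Subtype.val ⁻¹' K
  have hK' : IsCompact K' := by
    rw [Topology.IsInducing.subtypeVal.isCompact_iff]
    rwa [Set.image_preimage_eq_of_subset]
    simpa using hKU
  let n := t.card
  let i : Fin n ≃ t := t.equivFin.symm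
  let s : Fin n → Set U := fun j => Subtype.val ⁻¹' (e (i j)).source
  have hs : ∀ j, IsOpen (s j) := fun j => (e (i j)).open_source.preimage continuous_subtype_val
  have hcov : K' ⊆ ⋃ j, s j := by
    intro x hx
    obtain ⟨a, ha, hxa⟩ := Set.mem_iUnion₂.1 (ht hx)
    refine Set.mem_iUnion.2 ⟨i.symm ⟨a, ha⟩, ?_⟩
    simpa [s] using hxa
  obtain ⟨ρ, hρs, hρ1, -, hρc⟩ := exists_continuous_sum_one_of_isOpen_isCompact hs hK' hcov
  let F : Fin n → G → ℂ := fun j x => if h : x ∈ U then (ρ j ⟨x, h⟩ : ℂ) * f x else 0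
  have hsum : f = ∑ j, F j := by
    funext x
    rw [Finset.sum_apply]
    by_cases hx : x ∈ K
    · have hxU := hKU hx
      have h1 := hρ1 (show (⟨x, hxU⟩ : U) ∈ K' from hx)
      simp only [F, hxU, dite_true, ← Finset.sum_mul]
      have h2 : ∑ j, (ρ j ⟨x, hxU⟩ : ℂ) = 1 := by
        have : ∑ j, ρ j ⟨x, hxU⟩ = 1 := by simpa using h1
        exact_mod_cast this
      rw [h2, one_mul]
    · rw [h0 x hx]
      refine (Finset.sum_eq_zero fun j _ => ?_).symm
      simp [F, h0 x hx]
  rw [hsum]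
  refine Submodule.sum_mem _ fun j _ => Submodule.subset_span ?_
  refine ⟨(e (i j)).restrOpen U hU, ?_, ?_, Subtype.val '' tsupport (ρ j), ?_, ?_, ?_⟩
  · rw [(he (i j)).2]; rfl
  · have hc : ContinuousOn (F j) U := by
      rw [continuousOn_iff_continuous_domRestrict] at hfU ⊢
      have : U.domRestrict (F j) = fun x => (ρ j x : ℂ) * U.domRestrict f x := by
        funext x
        simp [F, Set.domRestrict]
      rw [this]
      exact (Complex.continuous_ofReal.comp (ρ j).continuous).mul hfU
    exact hc.mono (by simp)
  · rintro _ ⟨x, hx, rfl⟩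
    have := hρs j hx
    simp only [OpenPartialHomeomorph.restrOpen_source]
    exact ⟨this, x.2⟩
  · exact (hρc j).isCompact.image continuous_subtype_val
  · intro x hx
    by_cases hxU : x ∈ U
    · have : ρ j ⟨x, hxU⟩ = 0 := by
        apply image_eq_zero_of_notMem_tsupport
        exact fun h => hx ⟨_, h, rfl⟩
      simp [F, this]
    · simp [F, hxU]

theorem conv_slice_mem [T2Space (unitSpace G)] {f g : G → ℂ} (hf : f ∈ sliceFun G)
    (hg : g ∈ sliceFun G) : conv f g ∈ connesSpan G := by
  obtain ⟨e, he, hfc, K, hKe, hK, hK0⟩ := hf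
  obtain ⟨e', he', hgc, L, hLe, hL, hL0⟩ := hg
  have hrc : Continuous (rng : G → unitSpace G) := isLocalHomeomorph_rng.continuous
  have hsc : Continuous (src : G → unitSpace G) :=
    (IsEtaleGroupoid.isLocalHomeomorph_src (G := G)).continuous
  let φ : G → G := fun c => e.symm (rng c)
  let ψ : G → G := fun c => (φ c)⁻¹ * c
  let T : Set G := rng ⁻¹' e.target
  have hT : IsOpen T := e.open_target.preimage hrc
  have hφT : ContinuousOn φ T :=
    e.continuousOn_symm.comp hrc.continuousOn (fun _ h => h)
  have hφr : ∀ c ∈ T, rng (φ c) = rng c := by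
    intro c hc
    have := e.right_inv hc
    rwa [he] at this
  have hψT : ContinuousOn ψ T := by
    refine (IsTopologicalGroupoid.continuousOn_product (G := G)).comp
      ((continuous_inverse'.comp_continuousOn hφT).prodMk continuousOn_id) ?_
    intro c hc
    exact composable_inv_of_rng_eq (hφr c hc)
  have hφs : ∀ c ∈ T, φ c ∈ e.source := fun c hc => e.map_target hc
  let W : Set G := T ∩ ψ ⁻¹' e'.source
  have hW : IsOpen W := hψT.isOpen_inter_preimage hT e'.open_source
  have hφu : ∀ a c, a ∈ e.source → rng a = rng c → c ∈ T ∧ φ c = a := by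
    intro a c ha hac
    have h1 := e.map_source ha
    have h2 := e.left_inv ha
    rw [he, hac] at h1 h2
    exact ⟨h1, h2⟩
  have hval : ∀ c ∈ T, conv f g c = f (φ c) * g (ψ c) := by
    intro c hc
    have hm := hφr c hc
    rw [conv, finsum_eq_single _ ⟨(φ c, ψ c), composable_mul_inv_mul hm, mul_inv_mul hm⟩]
    rintro ⟨⟨a, b⟩, hab, hc'⟩ hne
    simp only at hab hc' ⊢
    by_cases ha : a ∈ e.source
    · exfalso
      apply hne
      have h1 : rng a = rng c := by rw [← hc', rng_mul hab]
      have h2 := (hφu a c ha h1).2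
      have h3 : ψ c = b := by
        change (φ c)⁻¹ * c = b
        rw [h2, ← hc', inv_mul_product hab]
      simp [h2, h3]
    · rw [hK0 a fun h => ha (hKe h), zero_mul]
  let D : Set (G × G) := (K ×ˢ L) ∩ {p | src p.1 = rng p.2}
  have hD : IsCompact D := (hK.prod hL).inter_right
    (isClosed_eq (hsc.comp continuous_fst) (hrc.comp continuous_snd))
  have hDc : D ⊆ {p : G × G | Composable p.1 p.2} := fun p hp => composable_of_src_eq_rng hp.2
  have hMc : IsCompact ((fun p : G × G => p.1 * p.2) '' D) :=
    hD.image_of_continuousOn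
      ((IsTopologicalGroupoid.continuousOn_product (G := G)).mono hDc)
  refine Submodule.subset_span ⟨W, hW, ?_, ?_, (fun p : G × G => p.1 * p.2) '' D, ?_, hMc, ?_⟩
  · refine T2Space.of_injective_continuous (f := fun c : W => rng c.1) ?_
      (hrc.comp continuous_subtype_val)
    rintro ⟨c, hc, hcψ⟩ ⟨d, hd, hdψ⟩ h
    simp only at h
    have h1 : φ c = φ d := congrArg e.symm h
    have h2 : ψ c = ψ d := by
      apply e'.injOn hcψ hdψ
      rw [he', ← src_eq_rng_of_composable (composable_mul_inv_mul (hφr c hc)),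
        ← src_eq_rng_of_composable (composable_mul_inv_mul (hφr d hd)), h1]
    apply Subtype.ext
    change c = d
    rw [← mul_inv_mul (hφr c hc), ← mul_inv_mul (hφr d hd)]
    change φ c * ψ c = φ d * ψ d
    rw [h1, h2]
  · refine ContinuousOn.congr (f := fun c => f (φ c) * g (ψ c)) ?_ (fun c hc => hval c hc.1)
    refine ContinuousOn.mul ?_ ?_
    · exact hfc.comp (hφT.mono Set.inter_subset_left) (fun c hc => hφs c hc.1)
    · exact hgc.comp (hψT.mono Set.inter_subset_left) (fun c hc => hc.2)
  · rintro _ ⟨⟨a, b⟩, hp, rfl⟩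
    have hab : Composable a b := hDc hp
    obtain ⟨h1, h2⟩ := hφu a (a * b) (hKe hp.1.1) (rng_mul hab).symm
    refine ⟨h1, ?_⟩
    change (φ (a * b))⁻¹ * (a * b) ∈ e'.source
    rw [h2, inv_mul_product hab]
    exact hLe hp.1.2
  · intro c hc
    rw [conv]
    refine finsum_eq_zero_of_forall_eq_zero ?_
    rintro ⟨⟨a, b⟩, hab, hc'⟩
    simp only at hab hc' ⊢
    by_cases ha : a ∈ K
    · by_cases hb : b ∈ L
      · exact absurd ⟨(a, b), ⟨⟨ha, hb⟩, src_eq_rng_of_composable hab⟩, hc'⟩ hc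
      · rw [hL0 b hb, mul_zero]
    · rw [hK0 a ha, zero_mul]

theorem sliceFun_subset [T2Space (unitSpace G)] :
    Submodule.span ℂ (sliceFun G) ≤ connesSpan G := by
  refine Submodule.span_le.2 ?_
  rintro f ⟨e, he, hf⟩
  refine Submodule.subset_span ⟨e.source, e.open_source, ?_, hf⟩
  refine T2Space.of_injective_continuous (f := fun c : e.source => rng c.1) ?_
    (isLocalHomeomorph_rng.continuous.comp continuous_subtype_val)
  intro c d h
  apply Subtype.ext
  apply e.injOn c.2 d.2
  rw [he]
  exact h

theorem conv_mem [LocallyCompactSpace G] [T2Space (unitSpace G)] {f g : G → ℂ}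
    (hf : f ∈ connesSpan G) (hg : g ∈ connesSpan G) : conv f g ∈ connesSpan G := by
  have hf' := mem_span_sliceFun hf
  have hg' := mem_span_sliceFun hg
  clear hf hg
  have key : ∀ f ∈ sliceFun G, conv f g ∈ connesSpan G := by
    intro f hf
    have hfin := finite_fiber_of_mem (sliceFun_subset (Submodule.subset_span hf))
    induction hg' using Submodule.span_induction with
    | mem g hg => exact conv_slice_mem hf hg
    | zero => rw [conv_zero_right]; exact zero_mem _
    | add g g' _ _ h h' => rw [conv_add_right hfin]; exact add_mem h h'
    | smul t g _ h => rw [conv_smul_right]; exact Submodule.smul_mem _ _ h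
  induction hf' using Submodule.span_induction with
  | mem f hf => exact key f hf
  | zero => rw [conv_zero_left]; exact zero_mem _
  | add f f' hf hf' h h' =>
    rw [conv_add_left (finite_fiber_of_mem (sliceFun_subset hf))
      (finite_fiber_of_mem (sliceFun_subset hf'))]
    exact add_mem h h'
  | smul t f _ h => rw [conv_smul_left]; exact Submodule.smul_mem _ _ h

theorem invol_mem {f : G → ℂ} (hf : f ∈ connesSpan G) : invol f ∈ connesSpan G := by
  induction hf using Submodule.span_induction with
  | mem f hf =>
    obtain ⟨U, hU, hT2, hfU, K, hKU, hK, h0⟩ := hf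
    refine Submodule.subset_span
      ⟨(fun a : G => a⁻¹) ⁻¹' U, hU.preimage continuous_inverse', ?_, ?_,
        (fun a : G => a⁻¹) ⁻¹' K, Set.preimage_mono hKU, ?_, ?_⟩
    · refine T2Space.of_injective_continuous
        (f := fun c : ((fun a : G => a⁻¹) ⁻¹' U : Set G) => (⟨c.1⁻¹, c.2⟩ : U)) ?_
        ((continuous_inverse'.comp continuous_subtype_val).subtype_mk _)
      intro c d h
      have h1 : c.1⁻¹ = d.1⁻¹ := congrArg Subtype.val h
      apply Subtype.ext
      rw [← inverse_inverse c.1, h1, inverse_inverse]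
    · exact Complex.continuous_conj.comp_continuousOn
        (hfU.comp continuous_inverse'.continuousOn (fun _ h => h))
    · exact (inverseHomeo G).isCompact_preimage.2 hK
    · intro x hx
      simp [invol, h0 x⁻¹ hx]
  | zero =>
    have : invol (0 : G → ℂ) = 0 := by funext c; simp [invol]
    rw [this]; exact zero_mem _
  | add f g _ _ hf hg =>
    have : invol (f + g) = invol f + invol g := by funext c; simp [invol]
    rw [this]; exact add_mem hf hg
  | smul t f _ hf =>
    have : invol (t • f) = (starRingEnd ℂ t) • invol f := by funext c; simp [invol]
    rw [this]; exact Submodule.smul_mem _ _ hf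

end topological

/-! ### Connes' algebra -/

/-- Connes' algebra `𝒞(G)`: with pointwise vector space operations, convolution as product and
`invol` as involution. -/
def ConnesAlgebra (G : Type*) [TopologicalSpace G] : Type _ := connesSpan G

section instances

variable [TopologicalSpace G]

noncomputable instance : AddCommGroup (ConnesAlgebra G) :=
  inferInstanceAs (AddCommGroup (connesSpan G))

noncomputable instance : Module ℂ (ConnesAlgebra G) :=
  inferInstanceAs (Module ℂ (connesSpan G))

/-- Elements of `𝒞(G)` are functions on `G`. -/
instance : CoeFun (ConnesAlgebra G) (fun _ => G → ℂ) := ⟨fun f => f.1⟩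

variable [ArrowGroupoid G] [IsEtaleGroupoid G]

noncomputable instance : Star (ConnesAlgebra G) := ⟨fun f => ⟨invol f.1, invol_mem f.2⟩⟩

variable [LocallyCompactSpace G] [T2Space (unitSpace G)]

noncomputable instance : Mul (ConnesAlgebra G) := ⟨fun f g => ⟨conv f.1 g.1, conv_mem f.2 g.2⟩⟩

noncomputable instance : NonUnitalNonAssocRing (ConnesAlgebra G) :=
  { (inferInstance : AddCommGroup (ConnesAlgebra G)),
    (inferInstance : Mul (ConnesAlgebra G)) with
    left_distrib := fun f _ _ => Subtype.ext (conv_add_right (finite_fiber_of_mem f.2))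
    right_distrib := fun f g _ => Subtype.ext
      (conv_add_left (finite_fiber_of_mem f.2) (finite_fiber_of_mem g.2))
    zero_mul := fun f => Subtype.ext (conv_zero_left f.1)
    mul_zero := fun f => Subtype.ext (conv_zero_right f.1) }

end instances

/-- The net `F` in `𝒞(G)` converges to `f` in the inductive limit topology: `F n → f` uniformly on
`G`, and there is a compact set that eventually contains `{x | F n x ≠ 0}`. -/
def TendstoILT [TopologicalSpace G] {ι : Type*} [Preorder ι] (F : ι → ConnesAlgebra G)
    (f : ConnesAlgebra G) : Prop :=
  TendstoUniformly (fun n => (F n : G → ℂ)) (f : G → ℂ) atTop ∧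
    ∃ K : Set G, IsCompact K ∧ ∀ᶠ n in atTop, Function.support (F n : G → ℂ) ⊆ K

end ArrowGroupoid

open MeasureTheory

/-! ### Continuity of extensions by zero -/

/-! The heart is an $L^1$ estimate for matrix coefficients. For a vector $\xi$, the map $h \mapsto
\langle \xi, \pi(h)\xi\rangle$ is a positive functional on $C_c(G^{(0)})$, hence given by a measure
$\mu_\xi$, and multiplicativity alone forces its mass to be at most $\|\xi\|^2$. Put $\nu =
s^*\mu_\xi + r^*\mu_\eta$, where the pullbacks integrate counting measures on fibres. If $f \in
C_c(U)$ with $U$ an open bisection, write $f = k * g$ with $k = |f|^{1/2}$ carried to the units by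
$r$ and $g = f/|f|^{1/2}$. Then $g^* * g$ is $|f|$ carried to the units by $s$, so Cauchy–Schwarz
gives $|\langle \eta, \pi(f)\xi\rangle| \le \|\pi(k)\eta\|\,\|\pi(g)\xi\| \le \int |f|\,d\nu$
(`enorm_inner_le_lintegral_of_mem_CcOn`).

A general $f$ is a sum of such functions, but when $G$ is not Hausdorff the summands may cancel, and
$\|f\|_\infty$ does not control them. The key point is that the inequality nevertheless passes to
sums, with $|f|$ itself under the integral (`enorm_sum_le_lintegral`): the overlap of one summand
with the other sets is redistributed among the other summands, up to an arbitrarily small $L^1$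
error.

Each open bisection has $\nu$-mass at most $\|\xi\|^2 + \|\eta\|^2$. If $n$ bisections cover a
compact $K$, every $f$ vanishing off $K$ therefore satisfies $\|\pi(f)\| \le 2n\|f\|_\infty$
(`exists_norm_le_of_support_subset`), which is the required continuity. -/

theorem ContinuousOn.continuous_of_eq_zero_off_isClosed {X E : Type*} [TopologicalSpace X]
    [TopologicalSpace E] [Zero E] {f : X → E} {O K : Set X} (hf : ContinuousOn f O)
    (hO : IsOpen O) (hK : IsClosed K) (hKO : K ⊆ O) (h0 : ∀ x ∉ K, f x = 0) : Continuous f := by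
  refine continuous_iff_continuousAt.2 fun x => ?_
  by_cases hx : x ∈ K
  · exact hf.continuousAt (hO.mem_nhds (hKO hx))
  · have : f =ᶠ[𝓝 x] fun _ => 0 := by
      filter_upwards [hK.isOpen_compl.mem_nhds hx] with y hy using h0 y hy
    exact continuousAt_const.congr this.symm

/-- Extension by zero of a compactly supported function along a map that restricts to an
injective local homeomorphism. -/
theorem IsLocalHomeomorph.exists_compactlySupported_extension {G X : Type*} [TopologicalSpace G]
    [TopologicalSpace X] [T2Space X] {p : G → X} (hp : IsLocalHomeomorph p) {U K : Set G}
    (hU : IsOpen U) (hinj : Set.InjOn p U) {f : G → ℝ} (hf : ContinuousOn f U) (hKU : K ⊆ U)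
    (hK : IsCompact K) (h0 : ∀ x ∉ K, f x = 0) :
    ∃ k : CompactlySupportedContinuousMap X ℝ,
      (∀ a ∈ U, k (p a) = f a) ∧ ∀ x ∉ p '' U, k x = 0 := by
  classical
  let k : X → ℝ := fun x => if h : x ∈ p '' U then f h.choose else 0
  have hkU : ∀ a ∈ U, k (p a) = f a := by
    intro a ha
    have h : p a ∈ p '' U := ⟨a, ha, rfl⟩
    simp only [k, h, dite_true]
    rw [hinj h.choose_spec.1 ha h.choose_spec.2]
  have hk0 : ∀ x ∉ p '' U, k x = 0 := fun x hx => by simp only [k, hx, dite_false]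
  have hpK : IsCompact (p '' K) := hK.image hp.continuous
  have hkK : ∀ x ∉ p '' K, k x = 0 := by
    intro x hx
    by_cases hxU : x ∈ p '' U
    · obtain ⟨a, ha, rfl⟩ := hxU
      rw [hkU a ha]
      exact h0 a fun h => hx ⟨a, h, rfl⟩
    · exact hk0 x hxU
  have hemb : IsOpenEmbedding fun a : U => p a :=
    (hp.comp hU.isOpenEmbedding_subtypeVal.isLocalHomeomorph).isOpenEmbedding_of_injective
      fun a b h => Subtype.ext (hinj a.2 b.2 h)
  have hcont : ContinuousOn k (p '' U) := by
    rintro _ ⟨a, ha, rfl⟩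
    refine ContinuousAt.continuousWithinAt ?_
    refine (hemb.continuousAt_iff (x := ⟨a, ha⟩)).1 ?_
    have h1 : (k ∘ fun a : U => p a) = fun a : U => f a := funext fun a => hkU a a.2
    rw [h1]
    exact (hf.continuousAt (hU.mem_nhds ha)).comp continuous_subtype_val.continuousAt
  have hc : Continuous k := hcont.continuous_of_eq_zero_off_isClosed (hp.isOpenMap U hU)
    hpK.isClosed (Set.image_mono hKU) hkK
  exact ⟨⟨⟨k, hc⟩, HasCompactSupport.intro hpK fun x hx => hkK x hx⟩, hkU, hk0⟩

namespace ArrowGroupoid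

/-! ### The spaces $C_c(U)$ and partitions of unity -/

section CcOn

variable {G : Type*} [TopologicalSpace G]

theorem eq_zero_of_mem_CcOn {U : Set G} {f : G → ℂ} (hf : f ∈ CcOn U) {x : G} (hx : x ∉ U) :
    f x = 0 := by
  obtain ⟨-, K, hKU, -, h0⟩ := hf
  exact h0 x fun h => hx (hKU h)

/-- `C_c(U)` as a linear subspace. -/
def ccSubmodule (U : Set G) : Submodule ℂ (G → ℂ) where
  carrier := CcOn U
  zero_mem' := ⟨continuousOn_const, ∅, Set.empty_subset _, isCompact_empty, fun _ _ => rfl⟩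
  add_mem' := by
    rintro f g ⟨hf, K, hKU, hK, h0⟩ ⟨hg, L, hLU, hL, h0'⟩
    refine ⟨hf.add hg, K ∪ L, Set.union_subset hKU hLU, hK.union hL, fun x hx => ?_⟩
    rw [Set.mem_union, not_or] at hx
    rw [Pi.add_apply, h0 x hx.1, h0' x hx.2, add_zero]
  smul_mem' := by
    rintro t f ⟨hf, K, hKU, hK, h0⟩
    refine ⟨continuousOn_const.smul hf, K, hKU, hK, fun x hx => ?_⟩
    rw [Pi.smul_apply, h0 x hx, smul_zero]

/-- Since $V$ is Hausdorff, the compact set carrying $f$ is closed in $V$, so extension by zero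
stays continuous on $V$. -/
theorem CcOn_mono {O V : Set G} (hO : IsOpen O) (hOV : O ⊆ V) [T2Space V] :
    (CcOn O : Set (G → ℂ)) ⊆ CcOn V := by
  rintro f ⟨hf, K, hKO, hK, h0⟩
  refine ⟨?_, K, hKO.trans hOV, hK, h0⟩
  rw [continuousOn_iff_continuous_domRestrict]
  have hK' : IsCompact (Subtype.val ⁻¹' K : Set V) := by
    rw [Topology.IsInducing.subtypeVal.isCompact_iff, Set.image_preimage_eq_of_subset]
    · exact hK
    · simpa using hKO.trans hOV
  refine ContinuousOn.continuous_of_eq_zero_off_isClosed (O := Subtype.val ⁻¹' O)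
    (K := Subtype.val ⁻¹' K) ?_ (hO.preimage continuous_subtype_val) hK'.isClosed
    (Set.preimage_mono hKO) fun x hx => h0 x hx
  exact hf.comp continuous_subtype_val.continuousOn fun _ h => h

theorem exists_norm_le_of_mem_CcOn {U : Set G} {f : G → ℂ} (hf : f ∈ CcOn U) :
    ∃ M, ∀ x, ‖f x‖ ≤ M := by
  obtain ⟨hc, K, hKU, hK, h0⟩ := hf
  obtain ⟨M, hM⟩ := hK.exists_bound_of_continuousOn (hc.mono hKU)
  refine ⟨max M 0, fun x => ?_⟩
  by_cases hx : x ∈ K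
  · exact (hM x hx).trans (le_max_left _ _)
  · simp [h0 x hx]

theorem measurable_of_mem_CcOn [MeasurableSpace G] [BorelSpace G] {U : Set G} (hU : IsOpen U)
    {f : G → ℂ} (hf : f ∈ CcOn U) : Measurable f := by
  refine measurable_of_restrict_of_restrict_compl hU.measurableSet ?_ ?_
  · exact (continuousOn_iff_continuous_domRestrict.1 hf.1).measurable
  · have : (Uᶜ : Set G).domRestrict f = fun _ => 0 := funext fun x =>
      eq_zero_of_mem_CcOn hf x.2
    rw [this]
    exact measurable_const

/-- Partition of unity, applied to a function in `C_c(U)`. -/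
theorem exists_partition_of_mem_CcOn [LocallyCompactSpace G] {ι : Type*} (s : Finset ι)
    {U C : Set G} (hU : IsOpen U) [T2Space U] {V : ι → Set G} (hV : ∀ i ∈ s, IsOpen (V i))
    (hC : IsCompact C) (hCU : C ⊆ U) (hCV : C ⊆ ⋃ i ∈ s, V i) {f : G → ℂ} (hf : f ∈ CcOn U) :
    ∃ g : ι → G → ℂ, (∀ i ∈ s, g i ∈ CcOn (U ∩ V i)) ∧ (∀ x ∈ C, ∑ i ∈ s, g i x = f x) ∧
      ∀ i ∈ s, ∀ x, ‖g i x‖ ≤ ‖f x‖ := by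
  classical
  have hLC : LocallyCompactSpace U := hU.locallyCompactSpace
  have hC' : IsCompact (Subtype.val ⁻¹' C : Set U) := by
    rw [Topology.IsInducing.subtypeVal.isCompact_iff, Set.image_preimage_eq_of_subset]
    · exact hC
    · simpa using hCU
  let W : Fin s.card → Set U := fun j => Subtype.val ⁻¹' V (s.equivFin.symm j)
  have hW : ∀ j, IsOpen (W j) := fun j =>
    (hV _ (s.equivFin.symm j).2).preimage continuous_subtype_val
  have hcov : (Subtype.val ⁻¹' C : Set U) ⊆ ⋃ j, W j := by
    intro x hx
    obtain ⟨i, hi, hxi⟩ := Set.mem_iUnion₂.1 (hCV hx)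
    refine Set.mem_iUnion.2 ⟨s.equivFin ⟨i, hi⟩, ?_⟩
    simpa [W] using hxi
  obtain ⟨ρ, hρs, hρ1, hρI, hρc⟩ := exists_continuous_sum_one_of_isOpen_isCompact hW hC' hcov
  let g : ι → G → ℂ := fun i x =>
    if h : i ∈ s ∧ x ∈ U then (ρ (s.equivFin ⟨i, h.1⟩) ⟨x, h.2⟩ : ℂ) * f x else 0
  refine ⟨g, ?_, ?_, ?_⟩
  · intro i hi
    have hVi : ∀ x, x ∈ tsupport (ρ (s.equivFin ⟨i, hi⟩)) → x.1 ∈ V i := by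
      intro x hx
      have := hρs _ hx
      simpa [W] using this
    refine ⟨ContinuousOn.mono ?_ Set.inter_subset_left,
      Subtype.val '' tsupport (ρ (s.equivFin ⟨i, hi⟩)), ?_,
      (hρc _).isCompact.image continuous_subtype_val, ?_⟩
    · have hfc := hf.1
      rw [continuousOn_iff_continuous_domRestrict] at hfc ⊢
      have : U.domRestrict (g i) =
          fun x => (ρ (s.equivFin ⟨i, hi⟩) x : ℂ) * U.domRestrict f x := by
        funext x
        simp [g, Set.domRestrict, hi]
      rw [this]
      exact (Complex.continuous_ofReal.comp (ρ _).continuous).mul hfc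
    · rintro _ ⟨x, hx, rfl⟩
      exact ⟨x.2, hVi x hx⟩
    · intro x hx
      by_cases hxU : x ∈ U
      · have : ρ (s.equivFin ⟨i, hi⟩) ⟨x, hxU⟩ = 0 := by
          apply image_eq_zero_of_notMem_tsupport
          exact fun h => hx ⟨_, h, rfl⟩
        simp [g, this]
      · simp [g, hxU]
  · intro x hx
    have hxU := hCU hx
    have h1 : ∑ j, ρ j ⟨x, hxU⟩ = 1 := by
      simpa using hρ1 (show (⟨x, hxU⟩ : U) ∈ Subtype.val ⁻¹' C from hx)
    have h2 : ∑ i ∈ s, g i x = ∑ j, (ρ j ⟨x, hxU⟩ : ℂ) * f x := by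
      rw [← Finset.sum_coe_sort]
      refine Fintype.sum_equiv s.equivFin _ _ fun i => ?_
      simp [g, hxU]
    rw [h2, ← Finset.sum_mul]
    have h3 : ∑ j, (ρ j ⟨x, hxU⟩ : ℂ) = 1 := by exact_mod_cast h1
    rw [h3, one_mul]
  · intro i hi x
    by_cases hxU : x ∈ U
    · have hI := hρI (s.equivFin ⟨i, hi⟩) ⟨x, hxU⟩
      simp only [g, hi, hxU, and_self, dite_true, norm_mul, Complex.norm_real]
      refine mul_le_of_le_one_left (norm_nonneg _) ?_
      rw [Real.norm_of_nonneg hI.1]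
      exact hI.2
    · simp [g, hxU]

end CcOn

end ArrowGroupoid

/-! ### The pullback of a measure along a local homeomorphism -/

section Pullback

variable {G X : Type*}

/-- The counting measure on the fibre of `p` over `x`. -/
noncomputable def fiberCount [MeasurableSpace G] (p : G → X) (x : X) : Measure G :=
  Measure.sum fun a : p ⁻¹' {x} => Measure.dirac a.1

theorem lintegral_fiberCount [MeasurableSpace G] (p : G → X) (x : X) {φ : G → ENNReal}
    (hφ : Measurable φ) : ∫⁻ a, φ a ∂fiberCount p x = ∑' a : p ⁻¹' {x}, φ a := by
  rw [fiberCount, lintegral_sum_measure]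
  exact tsum_congr fun a => lintegral_dirac' _ hφ

/-- A fibre of $p$ meets $U$ in at most one point, so at most one term of the sum survives. -/
theorem tsum_fiber_of_injOn {p : G → X} {U : Set G} (hinj : Set.InjOn p U) {φ : G → ENNReal}
    (hφ : ∀ a ∉ U, φ a = 0) {h : X → ENNReal} (hh : ∀ a ∈ U, h (p a) = φ a)
    (h0 : ∀ x ∉ p '' U, h x = 0) (x : X) : ∑' a : p ⁻¹' {x}, φ a = h x := by
  by_cases hx : x ∈ p '' U
  · obtain ⟨a, ha, rfl⟩ := hx
    rw [tsum_eq_single ⟨a, rfl⟩, hh a ha]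
    rintro ⟨b, hb⟩ hne
    refine hφ b fun hbU => hne ?_
    exact Subtype.ext (hinj hbU ha hb)
  · rw [h0 x hx]
    refine ENNReal.tsum_eq_zero.2 fun a => hφ _ fun ha => hx ⟨a, ha, a.2⟩

theorem fiberCount_apply_of_injOn [MeasurableSpace G] {p : G → X} {U : Set G} (hinj : Set.InjOn p U)
    (hU : MeasurableSet U) (x : X) : fiberCount p x U = (p '' U).indicator 1 x := by
  rw [← lintegral_indicator_one hU, lintegral_fiberCount p x (measurable_one.indicator hU)]
  refine tsum_fiber_of_injOn hinj (fun a ha => Set.indicator_of_notMem ha _) (fun a ha => ?_)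
    (fun x hx => Set.indicator_of_notMem hx _) x
  rw [Set.indicator_of_mem ha, Set.indicator_of_mem (Set.mem_image_of_mem p ha)]
  rfl

variable [TopologicalSpace G] [TopologicalSpace X] [MeasurableSpace G] [BorelSpace G]
  [MeasurableSpace X] [BorelSpace X]

theorem IsLocalHomeomorph.measurableSet_image {p : G → X} (hp : IsLocalHomeomorph p) {U E : Set G}
    (hU : IsOpen U) (hinj : Set.InjOn p U) (hEU : E ⊆ U) (hE : MeasurableSet E) :
    MeasurableSet (p '' E) := by
  have hemb : IsOpenEmbedding fun a : U => p a :=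
    (hp.comp hU.isOpenEmbedding_subtypeVal.isLocalHomeomorph).isOpenEmbedding_of_injective
      fun a b h => Subtype.ext (hinj a.2 b.2 h)
  have h1 := hemb.measurableEmbedding.measurableSet_image.2
    (hE.preimage (measurable_subtype_coe (p := fun a => a ∈ U)))
  convert h1 using 1
  ext x
  constructor
  · rintro ⟨a, ha, rfl⟩
    exact ⟨⟨a, hEU ha⟩, ha, rfl⟩
  · rintro ⟨a, ha, rfl⟩
    exact ⟨a, ha, rfl⟩

/-- Countably many open sets on which $p$ is injective cover $G$. After making them disjoint, the
fibre count of $E$ is a countable sum of indicators of the images of the pieces, and these images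
are Borel. -/
theorem IsLocalHomeomorph.measurable_fiberCount [SecondCountableTopology G] {p : G → X}
    (hp : IsLocalHomeomorph p) : Measurable (fiberCount p) := by
  refine Measure.measurable_of_measurable_coe _ fun E hE => ?_
  rcases isEmpty_or_nonempty G with hG | hG
  · have : E = ∅ := Set.eq_empty_of_isEmpty E
    simp [this]
  choose e he using hp
  obtain ⟨t, ht, htu⟩ := TopologicalSpace.countable_cover_nhds
    (f := fun a => (e a).source) fun a => (e a).open_source.mem_nhds (he a).1
  have hne : t.Nonempty := by
    obtain ⟨a⟩ := hG
    have : a ∈ ⋃ x ∈ t, (e x).source := htu ▸ Set.mem_univ a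
    obtain ⟨x, hx, -⟩ := Set.mem_iUnion₂.1 this
    exact ⟨x, hx⟩
  obtain ⟨c, rfl⟩ := ht.exists_eq_range hne
  let U : ℕ → Set G := fun n => (e (c n)).source
  have hU : ∀ n, IsOpen (U n) := fun n => (e (c n)).open_source
  have hUinj : ∀ n, Set.InjOn p (U n) := fun n => by
    have := (e (c n)).injOn
    rwa [← (he (c n)).2] at this
  have hUm : ∀ n, MeasurableSet (disjointed U n) := MeasurableSet.disjointed
    fun n => (hU n).measurableSet
  have hcov : E = ⋃ n, E ∩ disjointed U n := by
    rw [← Set.inter_iUnion, iUnion_disjointed]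
    have : ⋃ n, U n = Set.univ := by simpa [U] using htu
    rw [this, Set.inter_univ]
  have hsub : ∀ n, E ∩ disjointed U n ⊆ U n := fun n =>
    Set.inter_subset_right.trans (disjointed_subset U n)
  have hval : ∀ x, fiberCount p x E = ∑' n, (p '' (E ∩ disjointed U n)).indicator 1 x := by
    intro x
    conv_lhs => rw [hcov]
    rw [measure_iUnion]
    · exact tsum_congr fun n =>
        fiberCount_apply_of_injOn ((hUinj n).mono (hsub n)) (hE.inter (hUm n)) x
    · intro i j hij
      exact (disjoint_disjointed U hij).mono Set.inter_subset_right Set.inter_subset_right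
    · exact fun n => hE.inter (hUm n)
  simp only [hval]
  refine Measurable.tsum fun n => measurable_one.indicator ?_
  exact IsLocalHomeomorph.measurableSet_image (fun a => ⟨e a, he a⟩) (hU n) (hUinj n) (hsub n)
    (hE.inter (hUm n))

/-- The pullback of `μ` along `p`: integrate against `μ` the counting measures on the fibres. -/
noncomputable def fiberMeasure (p : G → X) (μ : Measure X) : Measure G := μ.bind (fiberCount p)

theorem lintegral_fiberMeasure_of_injOn [SecondCountableTopology G] {p : G → X}
    (hp : IsLocalHomeomorph p) (μ : Measure X) {U : Set G} (hinj : Set.InjOn p U)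
    {φ : G → ENNReal} (hφm : Measurable φ) (hφ : ∀ a ∉ U, φ a = 0) {h : X → ENNReal}
    (hh : ∀ a ∈ U, h (p a) = φ a) (h0 : ∀ x ∉ p '' U, h x = 0) :
    ∫⁻ a, φ a ∂fiberMeasure p μ = ∫⁻ x, h x ∂μ := by
  rw [fiberMeasure, Measure.lintegral_bind hp.measurable_fiberCount.aemeasurable hφm.aemeasurable]
  refine lintegral_congr fun x => ?_
  rw [lintegral_fiberCount p x hφm, tsum_fiber_of_injOn hinj hφ hh h0 x]

theorem fiberMeasure_le_of_injOn [SecondCountableTopology G] {p : G → X}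
    (hp : IsLocalHomeomorph p) (μ : Measure X) {U : Set G} (hinj : Set.InjOn p U)
    (hU : MeasurableSet U) : fiberMeasure p μ U ≤ μ Set.univ := by
  rw [fiberMeasure, Measure.bind_apply hU hp.measurable_fiberCount.aemeasurable]
  refine (lintegral_mono (g := fun _ => 1) fun x => ?_).trans (by simp)
  simp only [fiberCount_apply_of_injOn hinj hU]
  exact Set.indicator_le_self' (by simp) x

end Pullback

namespace ArrowGroupoid

/-! ### Extending an `L¹` estimate from `C_c(U)` to sums -/

section Estimate

variable {G : Type*} [TopologicalSpace G] [LocallyCompactSpace G] [SecondCountableTopology G]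
  [MeasurableSpace G] [BorelSpace G]

/-- The support of $f$ need not be covered by the $V_i$, so an exact splitting over $U \cap \bigcup
V_i$ is not available. That set is exhausted by compact sets $C_n$, with an exact splitting on each;
the error tends to zero pointwise on $\bigcup V_i$, and dominated convergence applies. -/
theorem exists_decomposition_of_mem_CcOn (ν : Measure G) {ι : Type*} (s : Finset ι) {U : Set G}
    (hU : IsOpen U) [T2Space U] (hνU : ν U ≠ ⊤) {V : ι → Set G} (hV : ∀ i ∈ s, IsOpen (V i))
    {f : G → ℂ} (hf : f ∈ CcOn U) {ε : ENNReal} (hε : 0 < ε) :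
    ∃ g : ι → G → ℂ, (∀ i ∈ s, g i ∈ CcOn (U ∩ V i)) ∧
      ∫⁻ x in ⋃ i ∈ s, V i, ‖f x - ∑ i ∈ s, g i x‖ₑ ∂ν < ε := by
  classical
  set O : Set G := U ∩ ⋃ i ∈ s, V i with hOdef
  have hVo : IsOpen (⋃ i ∈ s, V i) := isOpen_biUnion hV
  have hO : IsOpen O := hU.inter hVo
  have hLC : LocallyCompactSpace O := hO.locallyCompactSpace
  let C : ℕ → Set G := fun n => Subtype.val '' compactCovering O n
  have hC : ∀ n, IsCompact (C n) := fun n =>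
    (isCompact_compactCovering O n).image continuous_subtype_val
  have hCO : ∀ n, C n ⊆ O := by
    rintro n _ ⟨x, -, rfl⟩
    exact x.2
  choose g hg hgC hgf using fun n => exists_partition_of_mem_CcOn s hU hV (hC n)
    ((hCO n).trans Set.inter_subset_left) ((hCO n).trans Set.inter_subset_right) hf
  obtain ⟨M, hM⟩ := exists_norm_le_of_mem_CcOn hf
  have hfm := measurable_of_mem_CcOn hU hf
  have hlim : Tendsto
      (fun n => ∫⁻ x in ⋃ i ∈ s, V i, ‖f x - ∑ i ∈ s, g n i x‖ₑ ∂ν) atTop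
      (𝓝 (∫⁻ _ in ⋃ i ∈ s, V i, 0 ∂ν)) := by
    -- The pieces are bounded by $|f| \le M$ and vanish off $U$, so the error is at most $(1 +
    -- |s|)M$ on $U$ and zero elsewhere; this is integrable because $\nu(U)$ is finite.
    refine tendsto_lintegral_of_dominated_convergence
      (U.indicator fun _ => ENNReal.ofReal ((1 + s.card) * M)) (fun n => ?_) (fun n => ?_) ?_ ?_
    · refine (hfm.sub (Finset.measurable_fun_sum s fun i hi => ?_)).enorm
      exact measurable_of_mem_CcOn (hU.inter (hV i hi)) (hg n i hi)
    · refine ae_of_all _ fun x => ?_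
      by_cases hx : x ∈ U
      · simp only [Set.indicator_of_mem hx]
        rw [← ofReal_norm]
        refine ENNReal.ofReal_le_ofReal ?_
        calc ‖f x - ∑ i ∈ s, g n i x‖ ≤ ‖f x‖ + ‖∑ i ∈ s, g n i x‖ := norm_sub_le _ _
          _ ≤ M + ∑ i ∈ s, M := add_le_add (hM x) ((norm_sum_le _ _).trans
              (Finset.sum_le_sum fun i hi => (hgf n i hi x).trans (hM x)))
          _ = (1 + s.card) * M := by simp; ring
      · have h1 : ∑ i ∈ s, g n i x = 0 := Finset.sum_eq_zero fun i hi =>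
          eq_zero_of_mem_CcOn (hg n i hi) fun h => hx h.1
        simp [eq_zero_of_mem_CcOn hf hx, h1]
    · rw [lintegral_indicator_const hU.measurableSet]
      refine ENNReal.mul_ne_top ENNReal.ofReal_ne_top ?_
      exact ne_top_of_le_ne_top hνU (Measure.restrict_apply_le _ _)
    · rw [ae_restrict_iff' hVo.measurableSet]
      refine ae_of_all _ fun x hxV => ?_
      by_cases hx : x ∈ U
      · refine tendsto_const_nhds.congr' ?_
        have hxO : x ∈ O := ⟨hx, hxV⟩
        obtain ⟨n, hn⟩ := exists_mem_compactCovering (⟨x, hxO⟩ : O)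
        filter_upwards [eventually_ge_atTop n] with m hm
        rw [hgC m x ⟨_, compactCovering_subset O hm hn, rfl⟩]
        simp
      · refine tendsto_const_nhds.congr fun n => ?_
        have h1 : ∑ i ∈ s, g n i x = 0 := Finset.sum_eq_zero fun i hi =>
          eq_zero_of_mem_CcOn (hg n i hi) fun h => hx h.1
        simp [eq_zero_of_mem_CcOn hf hx, h1]
  rw [lintegral_zero] at hlim
  obtain ⟨n, hn⟩ := (hlim.eventually (gt_mem_nhds hε)).exists
  exact ⟨g n, hg n, hn⟩

/-- Induction on the number of summands. Most of $f_a$ over $O = \bigcup_{i \in s} U_i$ is moved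
into the other summands as functions $g_i \in C_c(U_a \cap U_i)$. The remainder $q$ has small $L^1$
norm on $O$, while the new sum over $s$ vanishes off $O$. The two are thus almost disjointly
supported, and their $L^1$ norms add up to that of the total, up to $\varepsilon$. -/
theorem enorm_sum_le_lintegral (ν : Measure G) (L : connesSpan G →ₗ[ℂ] ℂ) {ι : Type*}
    (U : ι → Set G) (hU : ∀ i, IsOpen (U i)) (hT2 : ∀ i, T2Space (U i)) (hν : ∀ i, ν (U i) ≠ ⊤)
    (hL : ∀ i, ∀ f : connesSpan G, (f : G → ℂ) ∈ CcOn (U i) → ‖L f‖ₑ ≤ ∫⁻ x, ‖f.1 x‖ₑ ∂ν)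
    (s : Finset ι) (f : ι → connesSpan G) (hf : ∀ i ∈ s, (f i : G → ℂ) ∈ CcOn (U i)) :
    ‖L (∑ i ∈ s, f i)‖ₑ ≤ ∫⁻ x, ‖∑ i ∈ s, (f i).1 x‖ₑ ∂ν := by
  classical
  induction s using Finset.induction_on generalizing f with
  | empty => simp
  | insert a s ha ih =>
    refine ENNReal.le_of_forall_pos_le_add fun ε hε _ => ?_
    have hfa := hf a (Finset.mem_insert_self a s)
    have hfs : ∀ i ∈ s, (f i).1 ∈ CcOn (U i) := fun i hi => hf i (Finset.mem_insert_of_mem hi)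
    have hT2a := hT2 a
    -- Half of $\varepsilon$, because the remainder enters the pointwise bound on $O$ twice.
    obtain ⟨g, hg, hgε⟩ := exists_decomposition_of_mem_CcOn ν s (hU a) (hν a)
      (V := U) (fun i _ => hU i) hfa (ε := (ε : ENNReal) / 2)
      (ENNReal.half_pos (by exact_mod_cast hε.ne'))
    have hgi : ∀ i ∈ s, g i ∈ CcOn (U i) := fun i hi =>
      have := hT2 i
      CcOn_mono ((hU a).inter (hU i)) Set.inter_subset_right (hg i hi)
    have hga : ∀ i ∈ s, g i ∈ CcOn (U a) := fun i hi =>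
      CcOn_mono ((hU a).inter (hU i)) Set.inter_subset_left (hg i hi)
    have hmem : ∀ i ∈ s, g i ∈ connesSpan G := fun i hi =>
      Submodule.subset_span ⟨U i, hU i, hT2 i, hgi i hi⟩
    let g' : ι → connesSpan G := fun i => if h : i ∈ s then ⟨g i, hmem i h⟩ else 0
    have hg' : ∀ i ∈ s, (g' i).1 = g i := fun i hi => by simp [g', hi]
    let q : connesSpan G := f a - ∑ i ∈ s, g' i
    have hq : ∀ x, q.1 x = (f a).1 x - ∑ i ∈ s, g i x := by
      intro x
      simp only [q, Submodule.coe_sub, Submodule.coe_sum, Pi.sub_apply, Finset.sum_apply]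
      rw [Finset.sum_congr rfl fun i hi => by rw [hg' i hi]]
    have hqU : q.1 ∈ CcOn (U a) := by
      have : q.1 = (f a).1 - ∑ i ∈ s, g i := by
        funext x
        rw [hq, Pi.sub_apply, Finset.sum_apply]
      rw [this]
      exact (ccSubmodule (U a)).sub_mem hfa (Submodule.sum_mem _ hga)
    have hsum : ∑ i ∈ insert a s, f i = ∑ i ∈ s, (f i + g' i) + q := by
      rw [Finset.sum_insert ha, Finset.sum_add_distrib]
      simp only [q]
      abel
    have hih := ih (fun i => f i + g' i) fun i hi => by
      refine (ccSubmodule (U i)).add_mem (hfs i hi) ?_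
      rw [hg' i hi]
      exact hgi i hi
    have hqm : Measurable fun x => ‖q.1 x‖ₑ := (measurable_of_mem_CcOn (hU a) hqU).enorm
    set O : Set G := ⋃ i ∈ s, U i with hO
    have hOm : MeasurableSet O := (isOpen_biUnion fun i _ => hU i).measurableSet
    -- Reverse triangle inequality: on $O$, $|A| + |q| \le |A + q| + 2|q|$; off $O$, $A = 0$ and no
    -- correction is needed.
    have hpt : ∀ x, ‖∑ i ∈ s, (f i + g' i).1 x‖ₑ + ‖q.1 x‖ₑ ≤
        ‖∑ i ∈ insert a s, (f i).1 x‖ₑ + O.indicator (fun x => 2 * ‖q.1 x‖ₑ) x := by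
      intro x
      have h1 : ∑ i ∈ insert a s, (f i).1 x = ∑ i ∈ s, (f i + g' i).1 x + q.1 x := by
        have := congrArg (fun F : connesSpan G => F.1 x) hsum
        simpa [Finset.sum_apply] using this
      by_cases hx : x ∈ O
      · rw [Set.indicator_of_mem hx, h1]
        set A := ∑ i ∈ s, (f i + g' i).1 x
        calc ‖A‖ₑ + ‖q.1 x‖ₑ = ‖A + q.1 x - q.1 x‖ₑ + ‖q.1 x‖ₑ := by rw [add_sub_cancel_right]
          _ ≤ ‖A + q.1 x‖ₑ + ‖q.1 x‖ₑ + ‖q.1 x‖ₑ := by gcongr; exact enorm_sub_le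
          _ = ‖A + q.1 x‖ₑ + 2 * ‖q.1 x‖ₑ := by ring
      · have h2 : ∑ i ∈ s, (f i + g' i).1 x = 0 := by
          refine Finset.sum_eq_zero fun i hi => ?_
          have hxi : x ∉ U i := fun h => hx (Set.mem_iUnion₂.2 ⟨i, hi, h⟩)
          change (f i).1 x + (g' i).1 x = 0
          rw [hg' i hi, eq_zero_of_mem_CcOn (hfs i hi) hxi, eq_zero_of_mem_CcOn (hgi i hi) hxi,
            add_zero]
        rw [Set.indicator_of_notMem hx, h1, h2]
        simp
    have hqO : ∫⁻ x, O.indicator (fun x => 2 * ‖q.1 x‖ₑ) x ∂ν ≤ ε := by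
      rw [lintegral_indicator hOm, lintegral_const_mul _ hqm]
      simp only [hq]
      calc 2 * ∫⁻ x in O, ‖(f a).1 x - ∑ i ∈ s, g i x‖ₑ ∂ν ≤ 2 * ((ε : ENNReal) / 2) := by
            gcongr
        _ = ε := ENNReal.mul_div_cancel (by simp) (by simp)
    calc ‖L (∑ i ∈ insert a s, f i)‖ₑ = ‖L (∑ i ∈ s, (f i + g' i)) + L q‖ₑ := by
          rw [hsum, map_add]
      _ ≤ ‖L (∑ i ∈ s, (f i + g' i))‖ₑ + ‖L q‖ₑ := enorm_add_le _ _
      _ ≤ ∫⁻ x, ‖∑ i ∈ s, (f i + g' i).1 x‖ₑ ∂ν + ∫⁻ x, ‖q.1 x‖ₑ ∂ν :=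
          add_le_add hih (hL a q hqU)
      _ = ∫⁻ x, (‖∑ i ∈ s, (f i + g' i).1 x‖ₑ + ‖q.1 x‖ₑ) ∂ν := (lintegral_add_right _ hqm).symm
      _ ≤ ∫⁻ x, (‖∑ i ∈ insert a s, (f i).1 x‖ₑ + O.indicator (fun x => 2 * ‖q.1 x‖ₑ) x) ∂ν :=
          lintegral_mono hpt
      _ = ∫⁻ x, ‖∑ i ∈ insert a s, (f i).1 x‖ₑ ∂ν
          + ∫⁻ x, O.indicator (fun x => 2 * ‖q.1 x‖ₑ) x ∂ν :=
          lintegral_add_right _ ((hqm.const_mul 2).indicator hOm)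
      _ ≤ _ := by gcongr

end Estimate

end ArrowGroupoid

namespace ArrowGroupoid

/-! ### The unit space -/

section Units

variable {G : Type*} [ArrowGroupoid G]

theorem rng_coe_unit (x : unitSpace G) : rng x.1 = x := by
  obtain ⟨_, a, rfl⟩ := x
  change rng (a⁻¹ * a) = src a
  rw [rng_mul (composable_inv_self a), ← src_inverse, inverse_inverse]

theorem rng_mul_self (b : G) : (rng b).1 * b = b := by
  have := product_mul_inv (composable_self_inv b)
  rwa [inverse_inverse] at this

theorem composable_rng_self (b : G) : Composable (rng b).1 b :=
  composable_mul_left (composable_self_inv b) (composable_inv_self b)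

theorem src_coe_unit (x : unitSpace G) : src x.1 = x := by
  have h1 := composable_rng_self x.1
  have h2 := rng_mul_self x.1
  rw [rng_coe_unit] at h1 h2
  have h3 := inv_mul_product h1
  rw [h2] at h3
  exact Subtype.ext h3

theorem inverse_coe_unit (x : unitSpace G) : x.1⁻¹ = x.1 := by
  have h1 : x.1 * x.1⁻¹ = x.1 := congrArg Subtype.val (rng_coe_unit x)
  have h2 := rng_mul_self x.1⁻¹
  rw [← src_inverse, inverse_inverse, src_coe_unit, h1] at h2
  exact h2.symm

theorem inverse_mem_unitSpace_iff {a : G} : a⁻¹ ∈ unitSpace G ↔ a ∈ unitSpace G := by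
  constructor
  · intro h
    have := inverse_coe_unit ⟨_, h⟩
    rw [inverse_inverse] at this
    rwa [this]
  · intro h
    rwa [inverse_coe_unit ⟨a, h⟩]

variable [TopologicalSpace G]

open Classical in
/-- Extension by zero of functions on the unit space. -/
noncomputable def unitExtFun (h : CompactlySupportedContinuousMap (unitSpace G) ℝ) (a : G) : ℂ :=
  if ha : a ∈ unitSpace G then h ⟨a, ha⟩ else 0

theorem unitExtFun_coe (h : CompactlySupportedContinuousMap (unitSpace G) ℝ) (x : unitSpace G) :
    unitExtFun h x.1 = h x := by
  simp [unitExtFun]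

theorem unitExtFun_of_notMem (h : CompactlySupportedContinuousMap (unitSpace G) ℝ) {a : G}
    (ha : a ∉ unitSpace G) : unitExtFun h a = 0 := by
  simp [unitExtFun, ha]

theorem unitExtFun_mem_CcOn (h : CompactlySupportedContinuousMap (unitSpace G) ℝ) :
    unitExtFun h ∈ CcOn (unitSpace G) := by
  refine ⟨?_, Subtype.val '' tsupport h, ?_,
    h.hasCompactSupport.isCompact.image continuous_subtype_val, fun a ha => ?_⟩
  · rw [continuousOn_iff_continuous_domRestrict]
    have : (unitSpace G).domRestrict (unitExtFun h) = fun x => (h x : ℂ) :=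
      funext fun x => unitExtFun_coe h x
    rw [this]
    exact Complex.continuous_ofReal.comp h.continuous
  · rintro _ ⟨x, -, rfl⟩
    exact x.2
  · by_cases hau : a ∈ unitSpace G
    · have : h ⟨a, hau⟩ = 0 := by
        apply image_eq_zero_of_notMem_tsupport
        exact fun h => ha ⟨_, h, rfl⟩
      simp [unitExtFun, this]
    · exact unitExtFun_of_notMem h hau

variable [IsEtaleGroupoid G]

theorem isLocalHomeomorph_src : IsLocalHomeomorph (src : G → unitSpace G) :=
  IsEtaleGroupoid.isLocalHomeomorph_src

/-- Near a unit $u$ the source map is injective, and $a$ and $s(a)$ both lie in that neighbourhood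
when $a$ is close to $u$. They have the same source, so $a = s(a)$ is a unit. -/
theorem isOpen_unitSpace : IsOpen (unitSpace G) := by
  refine isOpen_iff_mem_nhds.2 fun u hu => ?_
  obtain ⟨e, hue, he⟩ := isLocalHomeomorph_src u
  have hc : Continuous fun a : G => (src a).1 :=
    continuous_subtype_val.comp isLocalHomeomorph_src.continuous
  have h1 : e.source ∈ 𝓝 (src u).1 := by
    rw [src_coe_unit ⟨u, hu⟩]
    exact e.open_source.mem_nhds hue
  filter_upwards [e.open_source.mem_nhds hue, hc.continuousAt h1] with a ha hsa
  have : (src a).1 = a := by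
    apply e.injOn hsa ha
    rw [← he, src_coe_unit]
  rw [← this]
  exact (src a).2

instance [LocallyCompactSpace G] : LocallyCompactSpace (unitSpace G) :=
  isOpen_unitSpace.locallyCompactSpace

variable [T2Space (unitSpace G)]

/-- The inclusion of `C_c(G⁽⁰⁾)` in Connes' algebra. -/
noncomputable def unitExt :
    CompactlySupportedContinuousMap (unitSpace G) ℝ → ConnesAlgebra G := fun h =>
  ⟨unitExtFun h, Submodule.subset_span
    ⟨unitSpace G, isOpen_unitSpace, inferInstance, unitExtFun_mem_CcOn h⟩⟩

theorem unitExt_add (h k : CompactlySupportedContinuousMap (unitSpace G) ℝ) :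
    unitExt (h + k) = unitExt h + unitExt k := by
  refine Subtype.ext (funext fun a => ?_)
  change unitExtFun (h + k) a = unitExtFun h a + unitExtFun k a
  by_cases ha : a ∈ unitSpace G <;> simp [unitExtFun, ha]

theorem unitExt_smul (t : ℝ) (h : CompactlySupportedContinuousMap (unitSpace G) ℝ) :
    unitExt (t • h) = (t : ℂ) • unitExt h := by
  refine Subtype.ext (funext fun a => ?_)
  change unitExtFun (t • h) a = (t : ℂ) • unitExtFun h a
  by_cases ha : a ∈ unitSpace G <;> simp [unitExtFun, ha]

theorem star_unitExt (h : CompactlySupportedContinuousMap (unitSpace G) ℝ) :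
    star (unitExt h) = unitExt h := by
  refine Subtype.ext (funext fun a => ?_)
  change starRingEnd ℂ (unitExtFun h a⁻¹) = unitExtFun h a
  by_cases ha : a ∈ unitSpace G
  · rw [inverse_coe_unit ⟨a, ha⟩, unitExtFun_coe h ⟨a, ha⟩, Complex.conj_ofReal]
  · rw [unitExtFun_of_notMem h ha, unitExtFun_of_notMem h (mt inverse_mem_unitSpace_iff.1 ha),
      map_zero]

variable [LocallyCompactSpace G]

/-- The only factorization of $c$ with a unit on the left is $r(c)\,c$. -/
theorem unitExt_mul_apply (h : CompactlySupportedContinuousMap (unitSpace G) ℝ)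
    (g : ConnesAlgebra G) (c : G) : (unitExt h * g).1 c = h (rng c) * g.1 c := by
  change conv (unitExtFun h) g.1 c = _
  rw [conv, finsum_eq_single _ ⟨((rng c).1, c), composable_rng_self c, rng_mul_self c⟩]
  · simp [unitExtFun_coe]
  · rintro ⟨⟨a, b⟩, hab, hc⟩ hne
    simp only at hab hc ⊢
    rw [unitExtFun_of_notMem, zero_mul]
    intro ha
    apply hne
    have h1 : rng b = ⟨a, ha⟩ := by
      rw [← src_eq_rng_of_composable hab, src_coe_unit ⟨a, ha⟩]
    have h2 : (rng b).1 = a := congrArg Subtype.val h1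
    have h3 : b = c := by rw [← hc, ← h2, rng_mul_self]
    simp [← h3, h2]

/-- If $a^{-1}, b \in U$ and $ab$ is defined, then $a^{-1}$ and $b$ have the same range, so $a =
b^{-1}$ and $ab = s(b)$. Hence the convolution lives on units, and injectivity of $s$ leaves one
term. -/
theorem star_mul_self_eq_unitExt {U : Set G} (hr : Set.InjOn (rng : G → unitSpace G) U)
    (hs : Set.InjOn (src : G → unitSpace G) U) {g : ConnesAlgebra G} (hg : ∀ a ∉ U, g.1 a = 0)
    {h : CompactlySupportedContinuousMap (unitSpace G) ℝ}
    (hh : ∀ b ∈ U, h (src b) = ‖g.1 b‖ ^ 2) (h0 : ∀ x ∉ src '' U, h x = 0) :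
    star g * g = unitExt h := by
  refine Subtype.ext (funext fun c => ?_)
  change conv (invol g.1) g.1 c = unitExtFun h c
  have key : ∀ a b : G, Composable a b → a * b = c → invol g.1 a * g.1 b ≠ 0 →
      b ∈ U ∧ a = b⁻¹ ∧ c = (src b).1 := by
    intro a b hab hc hne
    have ha : a⁻¹ ∈ U := by
      by_contra ha
      exact hne (by simp [invol, hg _ ha])
    have hb : b ∈ U := by
      by_contra hb
      exact hne (by simp [hg _ hb])
    have h1 : a⁻¹ = b := hr ha hb (by
      rw [← src_eq_rng_of_composable hab, ← src_inverse, inverse_inverse])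
    have h2 : a = b⁻¹ := by rw [← h1, inverse_inverse]
    exact ⟨hb, h2, by rw [← hc, h2]; rfl⟩
  by_cases hc : ∃ b ∈ U, c = (src b).1
  · obtain ⟨b, hb, rfl⟩ := hc
    rw [unitExtFun_coe, hh b hb, conv,
      finsum_eq_single _ ⟨(b⁻¹, b), composable_inv_self b, rfl⟩]
    · simp only [invol, inverse_inverse]
      rw [mul_comm, Complex.mul_conj, Complex.normSq_eq_norm_sq]
    · rintro ⟨⟨a, b'⟩, hab, hc⟩ hne
      by_contra h1
      obtain ⟨hb', rfl, hsb⟩ := key a b' hab hc h1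
      apply hne
      have : b' = b := hs hb' hb (Subtype.ext hsb.symm)
      simp [this]
  · have h1 : conv (invol g.1) g.1 c = 0 := by
      refine finsum_eq_zero_of_forall_eq_zero ?_
      rintro ⟨⟨a, b⟩, hab, hc'⟩
      by_contra h1
      obtain ⟨hb, -, hcb⟩ := key a b hab hc' h1
      exact hc ⟨b, hb, hcb⟩
    rw [h1]
    by_cases hcu : c ∈ unitSpace G
    · have h2 : h ⟨c, hcu⟩ = 0 := h0 _ fun ⟨b, hb, hbc⟩ => hc ⟨b, hb, by rw [hbc]⟩
      simp [unitExtFun, h2]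
    · rw [unitExtFun_of_notMem h hcu]

theorem star_unitExt_mul_self (k : CompactlySupportedContinuousMap (unitSpace G) ℝ) :
    star (unitExt k) * unitExt k = unitExt (k * k) := by
  refine star_mul_self_eq_unitExt (U := unitSpace G) ?_ ?_ (fun a => unitExtFun_of_notMem k) ?_ ?_
  · intro a ha b hb hab
    rw [rng_coe_unit ⟨a, ha⟩, rng_coe_unit ⟨b, hb⟩] at hab
    exact congrArg Subtype.val hab
  · intro a ha b hb hab
    rw [src_coe_unit ⟨a, ha⟩, src_coe_unit ⟨b, hb⟩] at hab
    exact congrArg Subtype.val hab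
  · intro b hb
    change _ = ‖unitExtFun k b‖ ^ 2
    rw [src_coe_unit ⟨b, hb⟩, unitExtFun_coe k ⟨b, hb⟩]
    simp [sq]
  · exact fun x hx => absurd ⟨x.1, x.2, src_coe_unit x⟩ hx

end Units

/-- The modulus is $\sqrt{|z|}$, which tends to zero at the origin, where division by zero also
gives the value $0$. -/
theorem continuous_div_sqrt_norm : Continuous fun z : ℂ => z / (√‖z‖ : ℂ) := by
  refine continuous_iff_continuousAt.2 fun z => ?_
  by_cases hz : z = 0
  · subst hz
    refine tendsto_iff_norm_sub_tendsto_zero.2 ?_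
    have h1 : Tendsto (fun z : ℂ => √‖z‖) (𝓝 0) (𝓝 0) := by
      have : Continuous fun z : ℂ => √‖z‖ := by fun_prop
      simpa using this.tendsto 0
    refine h1.congr fun w => ?_
    simp [abs_of_nonneg (Real.sqrt_nonneg _), Real.div_sqrt]
  · have h1 : (√‖z‖ : ℂ) ≠ 0 := by
      exact_mod_cast (Real.sqrt_pos.2 (norm_pos_iff.2 hz)).ne'
    have h2 : Continuous fun z : ℂ => (√‖z‖ : ℂ) := by fun_prop
    exact continuousAt_id.div h2.continuousAt h1

/-! ### Measures on the unit space attached to a representation -/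

section Representation

variable {G : Type*} [TopologicalSpace G] [ArrowGroupoid G] [IsEtaleGroupoid G]
  [LocallyCompactSpace G] [T2Space (unitSpace G)]
  {H : Type*} [NormedAddCommGroup H] [InnerProductSpace ℂ H] [CompleteSpace H]
  (π : ConnesAlgebra G →⋆ₙₐ[ℂ] (H →L[ℂ] H))

theorem norm_sq_apply_eq_re_inner (F : ConnesAlgebra G) (ξ : H) :
    ‖π F ξ‖ ^ 2 = RCLike.re (inner ℂ ξ (π (star F * F) ξ)) := by
  rw [map_mul, map_star, ContinuousLinearMap.star_eq_adjoint]
  exact ContinuousLinearMap.apply_norm_sq_eq_inner_adjoint_right (π F) ξ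

theorem norm_sq_apply_unitExt (k : CompactlySupportedContinuousMap (unitSpace G) ℝ) (ξ : H) :
    ‖π (unitExt k) ξ‖ ^ 2 = RCLike.re (inner ℂ ξ (π (unitExt (k * k)) ξ)) := by
  rw [norm_sq_apply_eq_re_inner, star_unitExt_mul_self]

/-- With $k = \sqrt h$, the quantity is $\|\pi(k)\xi\|^2$. -/
theorem re_inner_unitExt_nonneg {h : CompactlySupportedContinuousMap (unitSpace G) ℝ}
    (hh : 0 ≤ h) (ξ : H) : 0 ≤ RCLike.re (inner ℂ ξ (π (unitExt h) ξ)) := by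
  let k : CompactlySupportedContinuousMap (unitSpace G) ℝ :=
    ⟨⟨fun x => √(h x), Real.continuous_sqrt.comp h.continuous⟩,
      h.hasCompactSupport.comp_left Real.sqrt_zero⟩
  have hk : k * k = h := by
    ext x
    exact Real.mul_self_sqrt (hh x)
  rw [← hk, ← norm_sq_apply_unitExt]
  positivity

/-- The positive functional `h ↦ ⟪ξ, π(h) ξ⟫` on `C_c(G⁽⁰⁾)`. -/
noncomputable def unitFunctional (ξ : H) :
    CompactlySupportedContinuousMap (unitSpace G) ℝ →ₚ[ℝ] ℝ :=
  PositiveLinearMap.mk₀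
    { toFun := fun h => RCLike.re (inner ℂ ξ (π (unitExt h) ξ))
      map_add' := fun h k => by
        rw [unitExt_add, map_add, add_apply, inner_add_right, map_add]
      map_smul' := fun t h => by
        rw [unitExt_smul, map_smul, smul_apply, inner_smul_right]
        simp }
    fun _ hh => re_inner_unitExt_nonneg π hh ξ

theorem unitFunctional_apply (ξ : H) (h : CompactlySupportedContinuousMap (unitSpace G) ℝ) :
    unitFunctional π ξ h = RCLike.re (inner ℂ ξ (π (unitExt h) ξ)) := rfl

/-- A priori boundedness without any continuity of $\pi$: from $h^2 \le h$, $\|\pi(h)\xi\|^2 =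
\Lambda(h^2) \le \Lambda(h) \le \|\xi\|\,\|\pi(h)\xi\|$, and these inequalities force $\Lambda(h)
\le \|\xi\|^2$. -/
theorem unitFunctional_le {h : CompactlySupportedContinuousMap (unitSpace G) ℝ}
    (h0 : ∀ x, 0 ≤ h x) (h1 : ∀ x, h x ≤ 1) (ξ : H) : unitFunctional π ξ h ≤ ‖ξ‖ ^ 2 := by
  have hle : h * h ≤ h := fun x => mul_le_of_le_one_left (h0 x) (h1 x)
  have h2 : ‖π (unitExt h) ξ‖ ^ 2 ≤ unitFunctional π ξ h := by
    rw [norm_sq_apply_unitExt]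
    exact OrderHomClass.mono (unitFunctional π ξ) hle
  have h3 : unitFunctional π ξ h ≤ ‖ξ‖ * ‖π (unitExt h) ξ‖ := by
    rw [unitFunctional_apply]
    exact re_inner_le_norm _ _
  nlinarith [norm_nonneg ξ, norm_nonneg (π (unitExt h) ξ),
    sq_nonneg (‖ξ‖ - ‖π (unitExt h) ξ‖)]

variable [MeasurableSpace G] [BorelSpace G]

theorem rieszMeasure_unitFunctional_univ_le (ξ : H) :
    RealRMK.rieszMeasure (unitFunctional π ξ) Set.univ ≤ ENNReal.ofReal (‖ξ‖ ^ 2) := by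
  rw [isOpen_univ.measure_eq_iSup_isCompact]
  refine iSup₂_le fun K _ => iSup_le fun hK => ?_
  obtain ⟨f, hf1, -, hfc, hfI⟩ := exists_continuous_one_zero_of_isCompact hK
    (isClosed_empty : IsClosed (∅ : Set (unitSpace G))) (Set.disjoint_empty K)
  let k : CompactlySupportedContinuousMap (unitSpace G) ℝ := ⟨f, hfc⟩
  refine (RealRMK.rieszMeasure_le_of_eq_one (unitFunctional π ξ) (f := k)
    (fun x => (hfI x).1) hK fun x hx => hf1 hx).trans ?_
  exact ENNReal.ofReal_le_ofReal (unitFunctional_le π (fun x => (hfI x).1) (fun x => (hfI x).2) ξ)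

variable [SecondCountableTopology G]

theorem lintegral_fiberMeasure_rieszMeasure
    (Λ : CompactlySupportedContinuousMap (unitSpace G) ℝ →ₚ[ℝ] ℝ) {p : G → unitSpace G}
    (hp : IsLocalHomeomorph p) {U : Set G} (hU : IsOpen U) (hinj : Set.InjOn p U) {f : G → ℂ}
    (hf : f ∈ CcOn U) {h : CompactlySupportedContinuousMap (unitSpace G) ℝ}
    (hh : ∀ a ∈ U, h (p a) = ‖f a‖) (h0 : ∀ x ∉ p '' U, h x = 0) :
    ∫⁻ a, ‖f a‖ₑ ∂fiberMeasure p (RealRMK.rieszMeasure Λ) = ENNReal.ofReal (Λ h) := by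
  have hnn : ∀ x, 0 ≤ h x := by
    intro x
    by_cases hx : x ∈ p '' U
    · obtain ⟨a, ha, rfl⟩ := hx
      rw [hh a ha]
      exact norm_nonneg _
    · exact (h0 x hx).ge
  rw [lintegral_fiberMeasure_of_injOn hp _ hinj (measurable_of_mem_CcOn hU hf).enorm
    (h := fun x => ENNReal.ofReal (h x)) (fun a ha => by simp [eq_zero_of_mem_CcOn hf ha])
    (fun a ha => by rw [hh a ha, ofReal_norm]) (fun x hx => by simp [h0 x hx]),
    ← RealRMK.integral_rieszMeasure Λ h,
    ofReal_integral_eq_lintegral_ofReal _ (ae_of_all _ hnn)]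
  exact h.continuous.integrable_of_hasCompactSupport h.hasCompactSupport

/-- The measure on `G` dominating the matrix coefficient of `π` at `ξ` and `η`. -/
noncomputable def coefficientMeasure (ξ η : H) : Measure G :=
  fiberMeasure src (RealRMK.rieszMeasure (unitFunctional π ξ)) +
    fiberMeasure rng (RealRMK.rieszMeasure (unitFunctional π η))

/-- Splitting $f = k * g$ into two square roots of $|f|$, the phase kept in $g$, lets Cauchy–Schwarz
see $\eta$ only through $r$ and $\xi$ only through $s$; this is why $\nu$ has two terms. -/
theorem enorm_inner_le_lintegral_of_mem_CcOn {U : Set G} (hU : IsOpen U)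
    (hr : Set.InjOn (rng : G → unitSpace G) U) (hs : Set.InjOn (src : G → unitSpace G) U)
    (ξ η : H) (f : ConnesAlgebra G) (hf : f.1 ∈ CcOn U) :
    ‖inner ℂ η (π f ξ)‖ₑ ≤ ∫⁻ a, ‖f.1 a‖ₑ ∂coefficientMeasure π ξ η := by
  obtain ⟨hfc, K, hKU, hK, hf0⟩ := hf
  have hT2 : T2Space U := T2Space.of_injective_continuous (f := fun a : U => rng a.1)
    (fun a b h => Subtype.ext (hr a.2 b.2 h))
    (isLocalHomeomorph_rng.continuous.comp continuous_subtype_val)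
  obtain ⟨k, hkU, hk0⟩ := isLocalHomeomorph_rng.exists_compactlySupported_extension hU hr
    (f := fun a => √‖f.1 a‖) (Real.continuous_sqrt.comp_continuousOn hfc.norm) hKU hK
    (fun x hx => by simp [hf0 x hx])
  obtain ⟨h, hhU, hh0⟩ := isLocalHomeomorph_src.exists_compactlySupported_extension hU hs
    (f := fun a => ‖f.1 a‖) hfc.norm hKU hK (fun x hx => by simp [hf0 x hx])
  let g : ConnesAlgebra G := ⟨fun a => f.1 a / (√‖f.1 a‖ : ℂ), Submodule.subset_span
    ⟨U, hU, hT2, continuous_div_sqrt_norm.comp_continuousOn hfc, K, hKU, hK,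
      fun x hx => by simp [hf0 x hx]⟩⟩
  have hfU : ∀ a ∉ U, f.1 a = 0 := fun a ha => hf0 a fun h => ha (hKU h)
  have hfg : f = unitExt k * g := by
    refine Subtype.ext (funext fun a => ?_)
    rw [unitExt_mul_apply]
    by_cases ha : a ∈ U
    · rw [hkU a ha]
      change f.1 a = (√‖f.1 a‖ : ℂ) * (f.1 a / (√‖f.1 a‖ : ℂ))
      by_cases h0 : f.1 a = 0
      · simp [h0]
      · have h1 : (√‖f.1 a‖ : ℂ) ≠ 0 := by
          exact_mod_cast (Real.sqrt_pos.2 (norm_pos_iff.2 h0)).ne'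
        rw [mul_div_cancel₀ _ h1]
    · change f.1 a = (k (rng a) : ℂ) * (f.1 a / (√‖f.1 a‖ : ℂ))
      simp [hfU a ha]
  have hgg : star g * g = unitExt h := by
    refine star_mul_self_eq_unitExt hr hs (fun a ha => ?_) (fun b hb => ?_) hh0
    · change f.1 a / (√‖f.1 a‖ : ℂ) = 0
      simp [hfU a ha]
    · rw [hhU b hb]
      change ‖f.1 b‖ = ‖f.1 b / (√‖f.1 b‖ : ℂ)‖ ^ 2
      simp [abs_of_nonneg (Real.sqrt_nonneg _), Real.div_sqrt]
  have h1 : inner ℂ η (π f ξ) = inner ℂ (π (unitExt k) η) (π g ξ) := by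
    have hadj : ContinuousLinearMap.adjoint (π (unitExt k)) = π (unitExt k) := by
      rw [← ContinuousLinearMap.star_eq_adjoint, ← map_star, star_unitExt]
    rw [hfg, map_mul, mul_apply_eq_comp, ← ContinuousLinearMap.adjoint_inner_left, hadj]
  -- Cauchy–Schwarz followed by $xy \le x^2 + y^2$, with $\|\pi(g)\xi\|^2 = \Lambda_\xi(h)$ and
  -- $\|\pi(k)\eta\|^2 = \Lambda_\eta(k^2)$.
  have h2 : ‖inner ℂ η (π f ξ)‖ ≤ unitFunctional π ξ h + unitFunctional π η (k * k) := by
    rw [unitFunctional_apply, unitFunctional_apply, ← hgg, ← norm_sq_apply_eq_re_inner,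
      ← norm_sq_apply_unitExt, h1]
    have := norm_inner_le_norm (𝕜 := ℂ) (π (unitExt k) η) (π g ξ)
    nlinarith [sq_nonneg (‖π (unitExt k) η‖ - ‖π g ξ‖), sq_nonneg ‖π (unitExt k) η‖,
      sq_nonneg ‖π g ξ‖]
  rw [coefficientMeasure, lintegral_add_measure,
    lintegral_fiberMeasure_rieszMeasure _ isLocalHomeomorph_src hU hs ⟨hfc, K, hKU, hK, hf0⟩
      hhU hh0,
    lintegral_fiberMeasure_rieszMeasure _ isLocalHomeomorph_rng hU hr ⟨hfc, K, hKU, hK, hf0⟩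
      (h := k * k) (fun a ha => by
        rw [CompactlySupportedContinuousMap.mul_apply, hkU a ha]
        exact Real.mul_self_sqrt (norm_nonneg _))
      (fun x hx => by rw [CompactlySupportedContinuousMap.mul_apply, hk0 x hx, zero_mul]),
    ← ofReal_norm]
  exact (ENNReal.ofReal_le_ofReal h2).trans ENNReal.ofReal_add_le

theorem coefficientMeasure_le {U : Set G} (hU : IsOpen U)
    (hr : Set.InjOn (rng : G → unitSpace G) U) (hs : Set.InjOn (src : G → unitSpace G) U)
    (ξ η : H) : coefficientMeasure π ξ η U ≤ ENNReal.ofReal (‖ξ‖ ^ 2 + ‖η‖ ^ 2) := by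
  rw [coefficientMeasure, Measure.add_apply, ENNReal.ofReal_add (by positivity) (by positivity)]
  exact add_le_add
    ((fiberMeasure_le_of_injOn isLocalHomeomorph_src _ hs hU.measurableSet).trans
      (rieszMeasure_unitFunctional_univ_le π ξ))
    ((fiberMeasure_le_of_injOn isLocalHomeomorph_rng _ hr hU.measurableSet).trans
      (rieszMeasure_unitFunctional_univ_le π η))

end Representation

end ArrowGroupoid

namespace ArrowGroupoid

/-! ### Bisections -/

section Bisection

variable {G : Type*} [TopologicalSpace G] [ArrowGroupoid G]

/-- An open set on which the range and source maps are injective. -/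
structure IsOpenBisection (U : Set G) : Prop where
  isOpen : IsOpen U
  injOn_rng : Set.InjOn (rng : G → unitSpace G) U
  injOn_src : Set.InjOn (src : G → unitSpace G) U

variable [IsEtaleGroupoid G]

theorem exists_isOpenBisection (a : G) : ∃ U : Set G, a ∈ U ∧ IsOpenBisection U := by
  obtain ⟨e, ha, he⟩ := isLocalHomeomorph_rng a
  obtain ⟨e', ha', he'⟩ := isLocalHomeomorph_src a
  refine ⟨e.source ∩ e'.source, ⟨ha, ha'⟩, e.open_source.inter e'.open_source, ?_, ?_⟩
  · rw [he]
    exact e.injOn.mono Set.inter_subset_left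
  · rw [he']
    exact e'.injOn.mono Set.inter_subset_right

theorem IsOpenBisection.t2Space [T2Space (unitSpace G)] {U : Set G} (hU : IsOpenBisection U) :
    T2Space U :=
  T2Space.of_injective_continuous (f := fun a : U => rng a.1)
    (fun a b h => Subtype.ext (hU.injOn_rng a.2 b.2 h))
    (isLocalHomeomorph_rng.continuous.comp continuous_subtype_val)

end Bisection

/-! ### Compact supports and generation by open Hausdorff covers -/

theorem exists_isCompact_of_mem_connesSpan {G : Type*} [TopologicalSpace G] {f : G → ℂ}
    (hf : f ∈ connesSpan G) : ∃ K : Set G, IsCompact K ∧ ∀ x ∉ K, f x = 0 := by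
  induction hf using Submodule.span_induction with
  | mem f hf =>
    obtain ⟨-, -, -, -, K, -, hK, h0⟩ := hf
    exact ⟨K, hK, h0⟩
  | zero => exact ⟨∅, isCompact_empty, fun _ _ => rfl⟩
  | add f g _ _ hf hg =>
    obtain ⟨K, hK, h0⟩ := hf
    obtain ⟨L, hL, h0'⟩ := hg
    refine ⟨K ∪ L, hK.union hL, fun x hx => ?_⟩
    rw [Set.mem_union, not_or] at hx
    rw [Pi.add_apply, h0 x hx.1, h0' x hx.2, add_zero]
  | smul t f _ hf =>
    obtain ⟨K, hK, h0⟩ := hf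
    exact ⟨K, hK, fun x hx => by rw [Pi.smul_apply, h0 x hx, smul_zero]⟩

/-- A partition of unity inside each Hausdorff $U$ shows that functions supported in bisections
already span the algebra. -/
theorem connesSpan_le_iSup_ccSubmodule {G : Type*} [TopologicalSpace G] [LocallyCompactSpace G]
    {B : G → Set G} (hB : ∀ a, IsOpen (B a)) (hBT2 : ∀ a, T2Space (B a)) (haB : ∀ a, a ∈ B a) :
    connesSpan G ≤ ⨆ a, ccSubmodule (B a) := by
  refine Submodule.span_le.2 ?_
  rintro f ⟨U, hU, hT2, hf⟩
  obtain ⟨-, K, hKU, hK, h0⟩ := id hf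
  obtain ⟨t, -, ht⟩ := hK.elim_nhds_subcover B fun a _ => (hB a).mem_nhds (haB a)
  obtain ⟨g, hg, hgK, hgf⟩ :=
    exists_partition_of_mem_CcOn t hU (fun a _ => hB a) hK hKU ht hf
  have hsum : f = ∑ a ∈ t, g a := by
    funext x
    rw [Finset.sum_apply]
    by_cases hx : x ∈ K
    · exact (hgK x hx).symm
    · rw [h0 x hx]
      refine (Finset.sum_eq_zero fun a ha => ?_).symm
      have := hgf a ha x
      rwa [h0 x hx, norm_zero, norm_le_zero_iff] at this
  rw [SetLike.mem_coe, hsum]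
  refine Submodule.sum_mem _ fun a ha => Submodule.mem_iSup_of_mem a ?_
  have := hBT2 a
  exact CcOn_mono (hU.inter (hB a)) Set.inter_subset_right (hg a ha)

/-! ### Representations are bounded on functions supported in a compact set -/

theorem norm_le_of_norm_inner_le {H : Type*} [NormedAddCommGroup H] [InnerProductSpace ℂ H]
    {T : H →L[ℂ] H} {C : ℝ} (hC : 0 ≤ C)
    (hT : ∀ ξ η, ‖inner ℂ η (T ξ)‖ ≤ C * (‖ξ‖ ^ 2 + ‖η‖ ^ 2)) : ‖T‖ ≤ 2 * C := by
  refine T.opNorm_le_bound (by positivity) fun ξ => ?_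
  by_cases hTξ : T ξ = 0
  · rw [hTξ, norm_zero]
    positivity
  have hξ : 0 < ‖ξ‖ := norm_pos_iff.2 fun h => hTξ (by rw [h, map_zero])
  have hTξ' : 0 < ‖T ξ‖ := norm_pos_iff.2 hTξ
  -- The test vector is parallel to $T\xi$ and rescaled to the length of $\xi$, which makes the
  -- right side $2C\|\xi\|^2$.
  have h := hT ξ (((‖ξ‖ / ‖T ξ‖ : ℝ) : ℂ) • T ξ)
  rw [inner_smul_left, norm_mul, inner_self_eq_norm_sq_to_K, norm_smul] at h
  simp only [Complex.conj_ofReal, Complex.norm_real, Complex.coe_algebraMap, norm_pow,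
    norm_div, norm_norm] at h
  rw [div_mul_cancel₀ _ hTξ'.ne'] at h
  have h1 : ‖ξ‖ / ‖T ξ‖ * ‖T ξ‖ ^ 2 = ‖ξ‖ * ‖T ξ‖ := by field_simp
  have h2 : ‖ξ‖ * ‖T ξ‖ ≤ ‖ξ‖ * (2 * C * ‖ξ‖) := by
    calc ‖ξ‖ * ‖T ξ‖ ≤ C * (‖ξ‖ ^ 2 + ‖ξ‖ ^ 2) := by
          rw [← h1]
          simpa using h
      _ = ‖ξ‖ * (2 * C * ‖ξ‖) := by ring
  exact le_of_mul_le_mul_left h2 hξ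

variable {G : Type*} [TopologicalSpace G] [ArrowGroupoid G] [IsEtaleGroupoid G]
  [LocallyCompactSpace G] [T2Space (unitSpace G)] [SecondCountableTopology G]
  {H : Type*} [NormedAddCommGroup H] [InnerProductSpace ℂ H] [CompleteSpace H]
  (π : ConnesAlgebra G →⋆ₙₐ[ℂ] (H →L[ℂ] H))

/-- The matrix coefficient of `π` at `ξ` and `η`. -/
noncomputable def coefficient (ξ η : H) : ConnesAlgebra G →ₗ[ℂ] ℂ where
  toFun f := inner ℂ η (π f ξ)
  map_add' f g := by rw [map_add, add_apply, inner_add_right]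
  map_smul' t f := by
    rw [map_smul, smul_apply, inner_smul_right]
    rfl

theorem enorm_inner_le_lintegral [MeasurableSpace G] [BorelSpace G] (ξ η : H)
    (f : ConnesAlgebra G) :
    ‖inner ℂ η (π f ξ)‖ₑ ≤ ∫⁻ a, ‖f.1 a‖ₑ ∂coefficientMeasure π ξ η := by
  choose B haB hB using exists_isOpenBisection (G := G)
  have hf : f.1 ∈ ⨆ a, ccSubmodule (B a) :=
    connesSpan_le_iSup_ccSubmodule (fun a => (hB a).isOpen) (fun a => (hB a).t2Space) haB f.2
  obtain ⟨g, hg, hgf⟩ := (Submodule.mem_iSup_iff_exists_finsupp _ _).1 hf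
  let L : connesSpan G →ₗ[ℂ] ℂ := coefficient π ξ η
  let g' : G → connesSpan G := fun a =>
    ⟨g a, Submodule.subset_span ⟨B a, (hB a).isOpen, (hB a).t2Space, hg a⟩⟩
  have key := enorm_sum_le_lintegral (coefficientMeasure π ξ η) L B (fun a => (hB a).isOpen)
    (fun a => (hB a).t2Space)
    (fun a => ne_top_of_le_ne_top ENNReal.ofReal_ne_top
      (coefficientMeasure_le π (hB a).isOpen (hB a).injOn_rng (hB a).injOn_src ξ η))
    (fun a F hF => enorm_inner_le_lintegral_of_mem_CcOn π (hB a).isOpen (hB a).injOn_rng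
      (hB a).injOn_src ξ η F hF) g.support g' fun a _ => hg a
  have hsum : ∑ a ∈ g.support, g' a = f := by
    refine Subtype.ext ?_
    rw [← hgf, Submodule.coe_sum]
    rfl
  have hsum' : ∀ x, ∑ a ∈ g.support, (g' a).1 x = f.1 x := fun x => by
    rw [← hgf, Finsupp.sum, Finset.sum_apply]
  simp only [hsum'] at key
  rw [hsum] at key
  exact key

/-- The constant is twice the number of open bisections in a finite cover of $K$. The measure $\nu$
depends on $\xi$ and $\eta$, but its mass on that cover is bounded uniformly in terms of their
norms. -/
theorem exists_norm_le_of_support_subset {K : Set G} (hK : IsCompact K) :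
    ∃ C : ℝ, 0 ≤ C ∧ ∀ (f : ConnesAlgebra G) (ε : ℝ), 0 ≤ ε → (∀ x ∉ K, f.1 x = 0) →
      (∀ x, ‖f.1 x‖ ≤ ε) → ‖π f‖ ≤ C * ε := by
  let _ : MeasurableSpace G := borel G
  have _ : BorelSpace G := ⟨rfl⟩
  choose B haB hB using exists_isOpenBisection (G := G)
  obtain ⟨t, -, ht⟩ := hK.elim_nhds_subcover B fun a _ => (hB a).isOpen.mem_nhds (haB a)
  refine ⟨2 * t.card, by positivity, fun f ε hε hfK hfε => ?_⟩
  rw [mul_assoc]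
  refine norm_le_of_norm_inner_le (by positivity) fun ξ η => ?_
  have hUm : MeasurableSet (⋃ a ∈ t, B a) := (isOpen_biUnion fun a _ => (hB a).isOpen).measurableSet
  have h1 : ∫⁻ a, ‖f.1 a‖ₑ ∂coefficientMeasure π ξ η ≤
      ENNReal.ofReal (t.card * ε * (‖ξ‖ ^ 2 + ‖η‖ ^ 2)) :=
    calc ∫⁻ a, ‖f.1 a‖ₑ ∂coefficientMeasure π ξ η
        ≤ ∫⁻ a, (⋃ a ∈ t, B a).indicator (fun _ => ENNReal.ofReal ε) a
            ∂coefficientMeasure π ξ η := by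
          refine lintegral_mono fun x => ?_
          by_cases hx : x ∈ ⋃ a ∈ t, B a
          · rw [Set.indicator_of_mem hx, ← ofReal_norm]
            exact ENNReal.ofReal_le_ofReal (hfε x)
          · simp [hfK x fun h => hx (ht h)]
      _ = ENNReal.ofReal ε * coefficientMeasure π ξ η (⋃ a ∈ t, B a) :=
          lintegral_indicator_const hUm _
      _ ≤ ENNReal.ofReal ε * ∑ a ∈ t, ENNReal.ofReal (‖ξ‖ ^ 2 + ‖η‖ ^ 2) := by
          gcongr
          exact (measure_biUnion_finset_le t B).trans (Finset.sum_le_sum fun a _ =>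
            coefficientMeasure_le π (hB a).isOpen (hB a).injOn_rng (hB a).injOn_src ξ η)
      _ = ENNReal.ofReal (t.card * ε * (‖ξ‖ ^ 2 + ‖η‖ ^ 2)) := by
          rw [Finset.sum_const, nsmul_eq_mul, ENNReal.ofReal_mul (by positivity),
            ENNReal.ofReal_mul (by positivity), ENNReal.ofReal_natCast]
          ring
  have h2 := (enorm_inner_le_lintegral π ξ η f).trans h1
  rw [← ofReal_norm] at h2
  exact (ENNReal.ofReal_le_ofReal_iff (by positivity)).1 h2

end ArrowGroupoid

theorem mainTheorem2 {G : Type*} [TopologicalSpace G] [ArrowGroupoid G] [ArrowGroupoid.IsEtaleGroupoid G]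
    [SecondCountableTopology G] [LocallyCompactSpace G] [T2Space (ArrowGroupoid.unitSpace G)]
    {H : Type*} [NormedAddCommGroup H] [InnerProductSpace ℂ H] [CompleteSpace H]
    (π : ArrowGroupoid.ConnesAlgebra G →⋆ₙₐ[ℂ] (H →L[ℂ] H))
    {ι : Type*} [Preorder ι] [IsDirectedOrder ι] [Nonempty ι]
    (F : ι → ArrowGroupoid.ConnesAlgebra G) (f : ArrowGroupoid.ConnesAlgebra G) (hF : ArrowGroupoid.TendstoILT F f) :
    Tendsto (fun n => π (F n)) atTop (𝓝 (π f)) := by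
  obtain ⟨hu, K, hK, hFK⟩ := hF
  -- A compact set need not be closed here, so the limit $f$ is not known to vanish off $K$; its own
  -- compact set is added.
  obtain ⟨L, hL, hfL⟩ := ArrowGroupoid.exists_isCompact_of_mem_connesSpan f.2
  obtain ⟨C, hC, hbound⟩ := ArrowGroupoid.exists_norm_le_of_support_subset π (hK.union hL)
  refine Metric.tendsto_nhds.2 fun ε hε => ?_
  -- The constant $C$ may be zero; $C + 1$ keeps the quotient meaningful and the final inequality
  -- strict.
  have hδ : 0 < ε / (C + 1) := by positivity
  filter_upwards [Metric.tendstoUniformly_iff.1 hu _ hδ, hFK] with n hn hnK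
  have hsub : ∀ x, (F n - f).1 x = (F n).1 x - f.1 x := fun x => rfl
  have h := hbound (F n - f) (ε / (C + 1)) hδ.le (fun x hx => ?_) fun x => ?_
  · rw [dist_eq_norm, ← map_sub]
    refine h.trans_lt ?_
    rw [mul_div_assoc', div_lt_iff₀ (by positivity)]
    nlinarith
  · rw [Set.mem_union, not_or] at hx
    rw [hsub, hfL x hx.2, sub_zero]
    exact Function.notMem_support.1 fun h => hx.1 (hnK h)
  · rw [hsub, ← dist_eq_norm, dist_comm]
    exact (hn x).le
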